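/- Let $S=(S_t)_{t\ge0}$ be a driftless integer-valued subordinator, i.e. a process with values in $\{0,1,2,\dots\}$, starting from $0$, with independent and stationary increments and almost surely nondecreasing, right-continuous paths. Suppose that $S$ is written in compound Poisson form: for every $t\ge0$, $$S_t\overset{\mathrm d}{=}\sum_{i=1}^{N_t}Z_i ,$$ where $N$ is a Poisson process with intensity $\lambda>0$ and $Z_1,Z_2,\dots$ are i.i.d. random variables, independent of $N$, with values in $\{0,1,2,\dots\}$ and $P\{Z_1\ge1\}>0$. Let $q\in(0,1)$ and $a=\lambda P\{Z_1\ge1\}$, and define $(c_j)_{j\ge0}$ by $$c_0=1,\qquad c_j=\frac{1}{(1-q^{-j})P\{Z_1\ge1\}}\sum_{k=1}^{j}q^{-k}P\{Z_1=k\}\,c_{j-k},\quad j\ge1 .$$ Then $I_q=\int_0^\infty q^{S_t}\,dt$ is almost surely finite, the series $\sum_{j\ge0}c_jq^j$ converges absolutely and has a positive sum, the series $\sum_{j\ge0}c_je^{-aq^{-j}x}$ converges absolutely for every $x>0$, and the distribution of $I_q$ is absolutely continuous, concentrated on $(0,\infty)$, with the nonnegative density $$\phi_q(x)=\frac{a}{\sum_{j=0}^\infty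 c_jq^j}\sum_{j=0}^\infty c_je^{-aq^{-j}x},\qquad x>0 .$$ -/

import Mathlib

open MeasureTheory ProbabilityTheory Set Filter Topology
open scoped NNReal ENNReal

/-- A subordinator: a real-valued process started at `0`, with independent and stationary
increments, whose paths are almost surely nondecreasing and right-continuous (left limits exist
automatically for nondecreasing paths). -/
structure IsSubordinator {Ω : Type*} [MeasurableSpace Ω] (X : ℝ≥0 → Ω → ℝ) (P : Measure Ω) :
    Prop where
  measurable : ∀ t, Measurable (X t)
  zero : ∀ᵐ ω ∂P, X 0 ω = 0
  indep_increments : HasIndepIncrements X P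
  stationary_increments :
    ∀ s h : ℝ≥0, IdentDistrib (fun ω => X (s + h) ω - X s ω) (X h) P P
  monotone_paths : ∀ᵐ ω ∂P, Monotone fun t => X t ω
  rightContinuous_paths :
    ∀ᵐ ω ∂P, ∀ t, ContinuousWithinAt (fun s => X s ω) (Ici t) t

/-- An integer-valued subordinator (its drift is necessarily zero). -/
def IsIntegerValuedSubordinator {Ω : Type*} [MeasurableSpace Ω] (S : ℝ≥0 → Ω → ℕ)
    (P : Measure Ω) : Prop :=
  IsSubordinator (fun t ω => (S t ω : ℝ)) P

/-- A (homogeneous) Poisson process with intensity `r`. -/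
structure IsPoissonProcess {Ω : Type*} [MeasurableSpace Ω] (N : ℝ≥0 → Ω → ℕ) (r : ℝ≥0)
    (P : Measure Ω) : Prop where
  isSubordinator : IsIntegerValuedSubordinator N P
  hasLaw : ∀ t, HasLaw (N t) (poissonMeasure (r * t)) P

/-- The data of a compound Poisson sum: a Poisson process `N` with intensity `r` and an
independent i.i.d. sequence `Z 0, Z 1, …` of jumps with values in the nonnegative integers.
The jumps usually written `Z_1, Z_2, …` are `Z 0, Z 1, …`. -/
structure IsCompoundPoissonData {Ω : Type*} [MeasurableSpace Ω] (N : ℝ≥0 → Ω → ℕ)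
    (Z : ℕ → Ω → ℕ) (r : ℝ≥0) (P : Measure Ω) : Prop where
  poisson : IsPoissonProcess N r P
  measurable_jumps : ∀ i, Measurable (Z i)
  indep_jumps : iIndepFun Z P
  identDistrib_jumps : ∀ i, IdentDistrib (Z i) (Z 0) P P
  indep : IndepFun (fun ω t => N t ω) (fun ω i => Z i ω) P

/-- The compound Poisson sum `∑_{i=1}^{N_t} Z_i`. -/
def compoundSum {Ω : Type*} (N : ℝ≥0 → Ω → ℕ) (Z : ℕ → Ω → ℕ) (t : ℝ≥0) (ω : Ω) : ℕ :=
  ∑ i ∈ Finset.range (N t ω), Z i ω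

/-- The exponential functional `I_q = ∫_0^∞ q^{S_t} dt`. -/
noncomputable def expFunctional {Ω : Type*} (q : ℝ) (S : ℝ≥0 → Ω → ℕ) (ω : Ω) : ℝ :=
  ∫ t in Ioi (0 : ℝ), q ^ S t.toNNReal ω

/-- The coefficients `c_j`, for `m = P{Z_1 ≥ 1}` and `p k = P{Z_1 = k}`; the recurrence in its
usual form is `densityCoeff_eq`. -/
noncomputable def densityCoeff (q m : ℝ) (p : ℕ → ℝ) : ℕ → ℝ
  | 0 => 1
  | j + 1 => 1 / ((1 - q ^ (-((j + 1 : ℕ) : ℤ))) * m) *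
      ∑ k : Fin (j + 1),
        q ^ (-((k.val + 1 : ℕ) : ℤ)) * p (k.val + 1) * densityCoeff q m p (j - k.val)
termination_by j => j
decreasing_by omega

theorem densityCoeff_zero (q m : ℝ) (p : ℕ → ℝ) : densityCoeff q m p 0 = 1 := by
  rw [densityCoeff]

theorem densityCoeff_eq (q m : ℝ) (p : ℕ → ℝ) (j : ℕ) (hj : 1 ≤ j) :
    densityCoeff q m p j = 1 / ((1 - q ^ (-(j : ℤ))) * m) *
      ∑ k ∈ Finset.Icc 1 j, q ^ (-(k : ℤ)) * p k * densityCoeff q m p (j - k) := by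
  obtain ⟨n, rfl⟩ : ∃ n, j = n + 1 := ⟨j - 1, by omega⟩
  rw [densityCoeff]
  congr 1
  rw [Fin.sum_univ_eq_sum_range
    (fun k => q ^ (-((k + 1 : ℕ) : ℤ)) * p (k + 1) * densityCoeff q m p (n - k)) (n + 1),
    Finset.range_eq_Ico, ← Finset.Ico_add_one_right_eq_Icc,
    ← Finset.sum_Ico_add' (fun k : ℕ => q ^ (-(k : ℤ)) * p k * densityCoeff q m p (n + 1 - k))
      0 (n + 1) 1]
  refine Finset.sum_congr rfl fun k _ => ?_
  rw [Nat.add_sub_add_right]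

/-- The function `φ(x) = a / (∑_j c_j q^j) * ∑_j c_j exp (-a q^{-j} x)`. -/
noncomputable def seriesDensity (a q : ℝ) (c : ℕ → ℝ) (x : ℝ) : ℝ :=
  a / (∑' j, c j * q ^ j) * ∑' j : ℕ, c j * Real.exp (-(a * q ^ (-(j : ℤ)) * x))

/-! ### The coefficients and their generating function -/

section Coefficients

variable {q m : ℝ} {p : ℕ → ℝ}

/-! The law is identified by its moments. Write `m = P{Z_1 ≥ 1}`, `Φ(z) = m - ∑_{k≥1} p_k z^k` and
`C(z) = ∑ c_j z^j`. Conditioning on the Poisson count gives `E z^{S_t} = exp(-λ t Φ(z))`.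

Moments of `I = I_q`: pathwise, `I^{n+1} = (n+1) ∫ q^{S_t} (∫_t^∞ q^{S_u} du)^n dt`, and the tail
integral is `q^{S_t}` times a copy of `I` independent of `S_t`. Hence `E I^{n+1} = (n+1) / (λ
Φ(q^{n+1})) * E I^n` (`lintegral_pow_succ`). The recurrence for `c_j` says exactly that `m C(z) =
Φ(z) C(qz)` (`tsum_densityCoeff_mul_pow_eq`), so the product of the factors `1 / Φ(q^i)` telescopes
and `E I^n = n! / a^n * C(q^{n+1}) / C(q)` (`lintegral_pow_eq`).

Moments of the candidate: since `∫ x^n exp(-a q^{-j} x) dx = n! / a^{n+1} * q^{(n+1)j}`, integrating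
the series term by term gives the same numbers (`integral_pow_mul_tsum`).

Both sides have exponential moments of order `a/2`, so their moments determine them. The sign of the
series is not visible beforehand: the law of `I` plus the negative part of `φ` is compared with the
positive part, and continuity of `φ` then forces the negative part to vanish
(`eq_withDensity_of_forall_integral_pow_eq`). -/

theorem exists_forall_le_of_eventually_le_max {e : ℕ → ℝ} {r : ℕ → ℝ} (hr : Tendsto r atTop (𝓝 0))
    (he : ∀ j, ∀ B, (∀ i < j + 1, e i ≤ B) → e (j + 1) ≤ r (j + 1) * B) :
    ∃ B, 0 ≤ B ∧ ∀ j, e j ≤ B := by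
  -- From index `n` on the factor is below `1`, so any nonnegative bound for the first `n + 1` terms
  -- propagates.
  obtain ⟨n, hn⟩ := eventually_atTop.1 (hr.eventually (gt_mem_nhds (zero_lt_one' ℝ)))
  refine ⟨∑ i ∈ Finset.range (n + 1), |e i|,
    Finset.sum_nonneg fun _ _ => abs_nonneg _, fun j => ?_⟩
  have hB : (0 : ℝ) ≤ ∑ i ∈ Finset.range (n + 1), |e i| :=
    Finset.sum_nonneg fun _ _ => abs_nonneg _
  induction j using Nat.strong_induction_on with
  | _ j ih =>
    by_cases hj : j < n + 1
    · exact (le_abs_self _).trans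
        (Finset.single_le_sum (f := fun i => |e i|) (fun _ _ => abs_nonneg _)
          (Finset.mem_range.2 hj))
    · obtain ⟨k, rfl⟩ : ∃ k, j = k + 1 := ⟨j - 1, by omega⟩
      exact (he k _ ih).trans (mul_le_of_le_one_left hB (hn (k + 1) (by omega)).le)

/-- Clearing the negative powers, `q^{j+1} q^{-(k+1)} = q^{j-k}` attaches to `c_{j-k}`. The right
side becomes a Cauchy product coefficient of `p` with the coefficients of `C(qz)`. -/
theorem densityCoeff_succ_mul (hq0 : 0 < q) (hq1 : q < 1) (hm : 0 < m) (j : ℕ) :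
    m * (q ^ (j + 1) - 1) * densityCoeff q m p (j + 1) =
      ∑ k ∈ Finset.range (j + 1), p (k + 1) * (q ^ (j - k) * densityCoeff q m p (j - k)) := by
  have hq : q ^ (j + 1) ≠ 1 := (pow_lt_one₀ hq0.le hq1 (by omega)).ne
  have h : densityCoeff q m p (j + 1) = 1 / ((1 - q ^ (-((j + 1 : ℕ) : ℤ))) * m) *
      ∑ k ∈ Finset.range (j + 1),
        q ^ (-((k + 1 : ℕ) : ℤ)) * p (k + 1) * densityCoeff q m p (j - k) := by
    rw [densityCoeff, Fin.sum_univ_eq_sum_range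
      (fun k => q ^ (-((k + 1 : ℕ) : ℤ)) * p (k + 1) * densityCoeff q m p (j - k)) (j + 1)]
  have h1 : (1 - q ^ (-((j + 1 : ℕ) : ℤ))) = (q ^ (j + 1) - 1) / q ^ (j + 1) := by
    rw [zpow_neg, zpow_natCast]
    field_simp
  have h2 : q ^ (j + 1) - 1 ≠ 0 := sub_ne_zero.2 hq
  rw [h, h1]
  have h3 : m * (q ^ (j + 1) - 1) * (1 / ((q ^ (j + 1) - 1) / q ^ (j + 1) * m)) = q ^ (j + 1) := by
    field_simp
  rw [← mul_assoc, h3, Finset.mul_sum]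
  refine Finset.sum_congr rfl fun k hk => ?_
  have hk' : j + 1 = (k + 1) + (j - k) := by have := Finset.mem_range.1 hk; omega
  rw [hk', pow_add, zpow_neg, zpow_natCast]
  field_simp

/-- The recurrence only sees the weighted terms `q^i |c_i|`. A bound `B` on these gives `|c_{j+1}| ≤
B / (1 - q)`, hence a weighted bound with factor `q^{j+1} / (1 - q)`, which tends to `0`. -/
theorem exists_abs_densityCoeff_le (hq0 : 0 < q) (hq1 : q < 1) (hm : 0 < m) (hp : ∀ k, 0 ≤ p k)
    (hpm : HasSum (fun k => p (k + 1)) m) : ∃ K, 0 ≤ K ∧ ∀ j, |densityCoeff q m p j| ≤ K := by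
  set c := densityCoeff q m p with hc
  have hden : ∀ j : ℕ, 1 - q ≤ 1 - q ^ (j + 1) := fun j =>
    sub_le_sub_left (pow_le_of_le_one hq0.le hq1.le (by omega)) 1
  have hq1' : 0 < 1 - q := sub_pos.2 hq1
  have key : ∀ j, ∀ B, (∀ i < j + 1, q ^ i * |c i| ≤ B) → |c (j + 1)| ≤ B / (1 - q) := by
    intro j B hB
    have hB0 : 0 ≤ B := le_trans (by positivity) (hB 0 (by omega))
    have h := congrArg abs (densityCoeff_succ_mul (p := p) hq0 hq1 hm j)
    rw [← hc, abs_mul, abs_mul, abs_of_pos hm, abs_sub_comm,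
      abs_of_pos (hq1'.trans_le (hden j))] at h
    have h2 : m * (1 - q ^ (j + 1)) * |c (j + 1)| ≤ m * B := by
      rw [h]
      calc _ ≤ ∑ k ∈ Finset.range (j + 1), p (k + 1) * B := by
            refine (Finset.abs_sum_le_sum_abs _ _).trans (Finset.sum_le_sum fun k hk => ?_)
            rw [abs_mul, abs_mul, abs_of_nonneg (hp _), abs_of_pos (pow_pos hq0 _)]
            exact mul_le_mul_of_nonneg_left (hB _ (by omega)) (hp _)
        _ ≤ m * B := by
            rw [← Finset.sum_mul]
            exact mul_le_mul_of_nonneg_right (sum_le_hasSum _ (fun k _ => hp _) hpm) hB0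
    rw [mul_assoc] at h2
    rw [le_div_iff₀ hq1', mul_comm]
    exact (mul_le_mul_of_nonneg_right (hden j) (abs_nonneg _)).trans (le_of_mul_le_mul_left h2 hm)
  obtain ⟨B, hB0, hB⟩ := exists_forall_le_of_eventually_le_max (e := fun i => q ^ i * |c i|)
    (r := fun j => q ^ j * (1 / (1 - q)))
    (by simpa using (tendsto_pow_atTop_nhds_zero_of_lt_one hq0.le hq1).mul_const (1 / (1 - q)))
    (fun j B hB => by
      have := key j B hB
      calc q ^ (j + 1) * |c (j + 1)| ≤ q ^ (j + 1) * (B / (1 - q)) := by gcongr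
        _ = _ := by ring)
  refine ⟨max 1 (B / (1 - q)), by positivity, fun j => ?_⟩
  cases j with
  | zero => simp [hc, densityCoeff_zero]
  | succ j => exact (key j B fun i _ => hB i).trans (le_max_right _ _)

/-- The functional equation of the generating function of the coefficients. -/
theorem tsum_densityCoeff_mul_pow_eq (hq0 : 0 < q) (hq1 : q < 1) (hm : 0 < m) (hp : ∀ k, 0 ≤ p k)
    (hpm : HasSum (fun k => p (k + 1)) m) {z : ℝ} (hz0 : 0 ≤ z) (hz1 : z < 1) :
    m * ∑' j, densityCoeff q m p j * z ^ j =
      (m - ∑' k, p (k + 1) * z ^ (k + 1)) * ∑' j, densityCoeff q m p j * (q * z) ^ j := by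
  obtain ⟨K, hK0, hK⟩ := exists_abs_densityCoeff_le hq0 hq1 hm hp hpm
  set c := densityCoeff q m p with hc
  have hs : ∀ w : ℝ, 0 ≤ w → w < 1 → Summable fun j => ‖c j * w ^ j‖ := fun w hw0 hw1 =>
    Summable.of_nonneg_of_le (fun _ => norm_nonneg _) (fun j => by
      rw [norm_mul, Real.norm_eq_abs, Real.norm_eq_abs, abs_of_nonneg (pow_nonneg hw0 _)]
      exact mul_le_mul_of_nonneg_right (hK j) (pow_nonneg hw0 _))
      ((summable_geometric_of_lt_one hw0 hw1).mul_left K)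
  have hqz0 : 0 ≤ q * z := by positivity
  have hqz1 : q * z < 1 := by nlinarith
  have hg : Summable fun k => ‖p (k + 1) * z ^ k‖ :=
    Summable.of_nonneg_of_le (fun _ => norm_nonneg _) (fun j => by
      rw [norm_mul, Real.norm_eq_abs, Real.norm_eq_abs, abs_of_nonneg (pow_nonneg hz0 _),
        abs_of_nonneg (hp _)]
      exact mul_le_of_le_one_right (hp _) (pow_le_one₀ hz0 hz1.le)) hpm.summable
  have hprod := tsum_mul_tsum_eq_tsum_sum_range_of_summable_norm hg (hs _ hqz0 hqz1)
  -- This is where the recurrence for the coefficients enters.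
  have hcoef : ∀ j, ∑ k ∈ Finset.range (j + 1),
      p (k + 1) * z ^ k * (c (j - k) * (q * z) ^ (j - k)) =
      m * (q ^ (j + 1) - 1) * c (j + 1) * z ^ j := by
    intro j
    rw [hc, densityCoeff_succ_mul hq0 hq1 hm, Finset.sum_mul]
    refine Finset.sum_congr rfl fun k hk => ?_
    have hk' : j = k + (j - k) := by have := Finset.mem_range.1 hk; omega
    conv_rhs => rw [hk']
    rw [pow_add, mul_pow, Nat.add_sub_cancel_left]
    ring
  simp_rw [hcoef] at hprod
  have e1 : ∑' k, p (k + 1) * z ^ (k + 1) = z * ∑' k, p (k + 1) * z ^ k := by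
    rw [← tsum_mul_left]
    exact tsum_congr fun k => by ring
  have e2 := (hs z hz0 hz1).of_norm.tsum_eq_zero_add
  have e3 := (hs _ hqz0 hqz1).of_norm.tsum_eq_zero_add
  have hz' := ((summable_nat_add_iff 1).2 (hs z hz0 hz1).of_norm)
  have hqz' := ((summable_nat_add_iff 1).2 (hs _ hqz0 hqz1).of_norm)
  have e4 : z * ∑' j, m * (q ^ (j + 1) - 1) * c (j + 1) * z ^ j =
      m * (∑' j, c (j + 1) * (q * z) ^ (j + 1) - ∑' j, c (j + 1) * z ^ (j + 1)) := by
    rw [← hqz'.tsum_sub hz', ← tsum_mul_left, ← tsum_mul_left]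
    exact tsum_congr fun k => by ring
  rw [sub_mul, e1, mul_assoc, hprod, e4, e3, e2]
  ring

theorem tsum_mul_pow_lt (hp : ∀ k, 0 ≤ p k) (hm : 0 < m)
    (hpm : HasSum (fun k => p (k + 1)) m) {z : ℝ} (hz0 : 0 ≤ z) (hz1 : z < 1) :
    ∑' k, p (k + 1) * z ^ (k + 1) < m := by
  have h1 : ∀ k, p (k + 1) * z ^ (k + 1) ≤ z * p (k + 1) := fun k => by
    rw [mul_comm]
    exact mul_le_mul_of_nonneg_right (pow_le_of_le_one hz0 hz1.le (by omega)) (hp _)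
  have h2 : Summable fun k => p (k + 1) * z ^ (k + 1) :=
    Summable.of_nonneg_of_le (fun k => mul_nonneg (hp _) (by positivity)) h1
      (hpm.summable.mul_left z)
  calc _ ≤ ∑' k, z * p (k + 1) := h2.tsum_le_tsum h1 (hpm.summable.mul_left z)
    _ = z * m := by rw [tsum_mul_left, hpm.tsum_eq]
    _ < m := by nlinarith

theorem summable_mul_pow_of_abs_le {c : ℕ → ℝ} {K : ℝ} (hK : ∀ j, |c j| ≤ K) {z : ℝ} (hz0 : 0 ≤ z)
    (hz1 : z < 1) : Summable fun j => c j * z ^ j :=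
  Summable.of_norm_bounded ((summable_geometric_of_lt_one hz0 hz1).mul_left K) fun j => by
    rw [norm_mul, Real.norm_eq_abs, Real.norm_eq_abs, abs_of_nonneg (pow_nonneg hz0 _)]
    exact mul_le_mul_of_nonneg_right (hK j) (pow_nonneg hz0 _)

/-- The generating function of the coefficients is positive along powers of `q`. -/
theorem tsum_densityCoeff_mul_pow_pos (hq0 : 0 < q) (hq1 : q < 1) (hm : 0 < m) (hp : ∀ k, 0 ≤ p k)
    (hpm : HasSum (fun k => p (k + 1)) m) (n : ℕ) :
    0 < ∑' j, densityCoeff q m p j * (q ^ (n + 1)) ^ j := by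
  obtain ⟨K, hK0, hK⟩ := exists_abs_densityCoeff_le hq0 hq1 hm hp hpm
  set c := densityCoeff q m p with hc
  have hz : ∀ n : ℕ, q ^ (n + 1) < 1 := fun n => pow_lt_one₀ hq0.le hq1 (by omega)
  -- As `Φ > 0` on `[0, 1)`, the functional equation carries positivity of `C` from `qz` to `z`.
  have step : ∀ n : ℕ, 0 < ∑' j, c j * (q ^ (n + 1 + 1)) ^ j → 0 < ∑' j, c j * (q ^ (n + 1)) ^ j := by
    intro n hn
    have h := tsum_densityCoeff_mul_pow_eq hq0 hq1 hm hp hpm (pow_nonneg hq0.le (n + 1)) (hz n)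
    rw [← pow_succ', ← hc] at h
    have h2 := mul_pos (sub_pos.2 (tsum_mul_pow_lt hp hm hpm (pow_nonneg hq0.le (n + 1)) (hz n))) hn
    rw [← h] at h2
    exact (mul_pos_iff_of_pos_left hm).1 h2
  -- Near `0` the constant term `c_0 = 1` dominates.
  have large : ∀ᶠ n : ℕ in atTop, 0 < ∑' j, c j * (q ^ (n + 1)) ^ j := by
    have hlim : Tendsto (fun n : ℕ => q ^ (n + 1)) atTop (𝓝 0) :=
      (tendsto_add_atTop_iff_nat 1).2 (tendsto_pow_atTop_nhds_zero_of_lt_one hq0.le hq1)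
    have hbound : ∀ n : ℕ, 1 - q ^ (n + 1) * (K / (1 - q)) ≤ ∑' j, c j * (q ^ (n + 1)) ^ j := by
      intro n
      have hs := summable_mul_pow_of_abs_le hK (pow_nonneg hq0.le (n + 1)) (hz n)
      rw [hs.tsum_eq_zero_add]
      have h1 : -∑' j, c (j + 1) * (q ^ (n + 1)) ^ (j + 1) ≤ q ^ (n + 1) * (K / (1 - q)) := by
        rw [← tsum_neg, div_eq_mul_inv, ← tsum_geometric_of_lt_one hq0.le hq1, ← tsum_mul_left,
          ← tsum_mul_left]
        refine ((summable_nat_add_iff 1).2 hs).neg.tsum_le_tsum (fun j => ?_)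
          (((summable_geometric_of_lt_one hq0.le hq1).mul_left K).mul_left _)
        calc -(c (j + 1) * (q ^ (n + 1)) ^ (j + 1)) = -c (j + 1) * (q ^ (n + 1)) ^ (j + 1) := by ring
          _ ≤ K * (q ^ (n + 1)) ^ (j + 1) := by
              gcongr; exact (neg_le_abs _).trans (hK _)
          _ = q ^ (n + 1) * (K * (q ^ (n + 1)) ^ j) := by ring
          _ ≤ q ^ (n + 1) * (K * q ^ j) := by
              gcongr; exact pow_le_of_le_one hq0.le hq1.le (by omega)
      simp only [pow_zero, mul_one, hc, densityCoeff_zero]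
      rw [← hc]
      linarith
    have hlim2 : Tendsto (fun n : ℕ => 1 - q ^ (n + 1) * (K / (1 - q))) atTop (𝓝 1) := by
      simpa using (hlim.mul_const (K / (1 - q))).const_sub 1
    filter_upwards [hlim2.eventually (lt_mem_nhds zero_lt_one)] with n hn
    exact hn.trans_le (hbound n)
  obtain ⟨N, hN⟩ := eventually_atTop.1 large
  have down : ∀ k, 0 < ∑' j, c j * (q ^ (n + k + 1)) ^ j → 0 < ∑' j, c j * (q ^ (n + 1)) ^ j := by
    intro k
    induction k with
    | zero => exact id
    | succ k ih => exact fun h => ih (step (n + k) h)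
  exact down N (hN (n + N) (by omega))

end Coefficients

/-! ### Dirichlet-type series of exponentials -/

section ExponentialSeries

theorem MeasureTheory.integrable_tsum_of_summable_integral_norm {α E : Type*} [MeasurableSpace α]
    {μ : Measure α} [NormedAddCommGroup E] {F : ℕ → α → E} (hF : ∀ i, Integrable (F i) μ)
    (hsum : Summable fun i => ∫ a, ‖F i a‖ ∂μ)
    (hmeas : AEStronglyMeasurable (fun a => ∑' i, F i a) μ) :
    Integrable (fun a => ∑' i, F i a) μ := by
  refine ⟨hmeas, ?_⟩
  calc ∫⁻ a, ‖∑' i, F i a‖ₑ ∂μ ≤ ∫⁻ a, ∑' i, ‖F i a‖ₑ ∂μ :=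
        lintegral_mono fun a => enorm_tsum_le_tsum_enorm
    _ = ∑' i, ∫⁻ a, ‖F i a‖ₑ ∂μ := lintegral_tsum fun i => (hF i).1.enorm
    _ = ∑' i, ENNReal.ofReal (∫ a, ‖F i a‖ ∂μ) :=
        tsum_congr fun i => (ofReal_integral_norm_eq_lintegral_enorm (hF i)).symm
    _ < ∞ := hsum.tsum_ofReal_lt_top

theorem integrableOn_pow_mul_exp_neg_mul (n : ℕ) {b : ℝ} (hb : 0 < b) :
    IntegrableOn (fun x : ℝ => x ^ n * Real.exp (-(b * x))) (Ioi 0) ∧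
      ∫ x in Ioi (0 : ℝ), x ^ n * Real.exp (-(b * x)) = n.factorial / b ^ (n + 1) := by
  have hn : (0 : ℝ) < n + 1 := by positivity
  have key := Real.integral_rpow_mul_exp_neg_mul_Ioi hn hb
  simp only [add_sub_cancel_right, Real.rpow_natCast] at key
  have e : ∫ x in Ioi (0 : ℝ), x ^ n * Real.exp (-(b * x)) = n.factorial / b ^ (n + 1) := by
    rw [key, Real.Gamma_nat_eq_factorial, ← Nat.cast_succ, Real.rpow_natCast]
    simp [div_eq_mul_inv, mul_comm]
  -- A non-integrable function has integral `0` by convention, so a nonzero value proves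
  -- integrability.
  exact ⟨.of_integral_ne_zero (by rw [e]; positivity), e⟩

variable {a q : ℝ} {c : ℕ → ℝ} {K : ℝ}

theorem le_mul_zpow_neg (ha : 0 < a) (hq0 : 0 < q) (hq1 : q < 1) (j : ℕ) :
    a ≤ a * q ^ (-(j : ℤ)) := by
  rw [zpow_neg, zpow_natCast]
  exact le_mul_of_one_le_right ha.le ((one_le_inv₀ (pow_pos hq0 j)).2 (pow_le_one₀ hq0.le hq1.le))

/-- The inequality `e^{-y} ≤ 1/y` gives up the doubly exponential decay for a geometric majorant
uniform on `[δ, ∞)`. -/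
theorem norm_mul_exp_neg_zpow_le (ha : 0 < a) (hq0 : 0 < q) (hK : ∀ j, |c j| ≤ K)
    {δ x : ℝ} (hδ : 0 < δ) (hx : δ ≤ x) (j : ℕ) :
    ‖c j * Real.exp (-(a * q ^ (-(j : ℤ)) * x))‖ ≤ K / (a * δ) * q ^ j := by
  have hK0 : 0 ≤ K := (abs_nonneg _).trans (hK 0)
  have hy : 0 < a * q ^ (-(j : ℤ)) * δ := by positivity
  rw [norm_mul, Real.norm_eq_abs, Real.norm_eq_abs, Real.abs_exp]
  calc |c j| * Real.exp (-(a * q ^ (-(j : ℤ)) * x))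
      ≤ K * Real.exp (-(a * q ^ (-(j : ℤ)) * δ)) := by
        gcongr
        exact hK j
    _ ≤ K * (a * q ^ (-(j : ℤ)) * δ)⁻¹ := by
        gcongr
        rw [Real.exp_neg]
        exact inv_anti₀ hy ((le_add_of_nonneg_right zero_le_one).trans (Real.add_one_le_exp _))
    _ = K / (a * δ) * q ^ j := by
        rw [zpow_neg, zpow_natCast]
        field_simp

theorem summable_mul_exp_neg_zpow (ha : 0 < a) (hq0 : 0 < q) (hq1 : q < 1) (hK : ∀ j, |c j| ≤ K)
    {x : ℝ} (hx : 0 < x) : Summable fun j : ℕ => c j * Real.exp (-(a * q ^ (-(j : ℤ)) * x)) :=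
  Summable.of_norm_bounded ((summable_geometric_of_lt_one hq0.le hq1).mul_left (K / (a * x)))
    (norm_mul_exp_neg_zpow_le ha hq0 hK hx le_rfl)

theorem continuousOn_tsum_mul_exp_neg_zpow (ha : 0 < a) (hq0 : 0 < q) (hq1 : q < 1)
    (hK : ∀ j, |c j| ≤ K) :
    ContinuousOn (fun x => ∑' j : ℕ, c j * Real.exp (-(a * q ^ (-(j : ℤ)) * x))) (Ioi 0) := by
  refine continuousOn_of_forall_continuousAt fun x hx => ?_
  have hx2 : 0 < x / 2 := half_pos hx
  refine (continuousOn_tsum (s := Ioi (x / 2)) (fun j => by fun_prop)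
    ((summable_geometric_of_lt_one hq0.le hq1).mul_left (K / (a * (x / 2))))
    (fun j y hy => norm_mul_exp_neg_zpow_le ha hq0 hK hx2 (le_of_lt hy) j)).continuousAt
    (Ioi_mem_nhds (half_lt_self hx))

/-- Every rate `a q^{-j}` is at least `a`, so the factor `e^{ax/2}` costs at most half of it; the
`L¹` norms of the terms still decay like `q^j`. -/
theorem integrableOn_mul_exp_tsum (ha : 0 < a) (hq0 : 0 < q) (hq1 : q < 1)
    (hK : ∀ j, |c j| ≤ K) :
    IntegrableOn (fun x => Real.exp (a / 2 * x) *
      ∑' j : ℕ, c j * Real.exp (-(a * q ^ (-(j : ℤ)) * x))) (Ioi 0) := by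
  have hK0 : 0 ≤ K := (abs_nonneg _).trans (hK 0)
  have hb : ∀ j : ℕ, a * q ^ (-(j : ℤ)) / 2 ≤ a * q ^ (-(j : ℤ)) - a / 2 := fun j => by
    linarith [le_mul_zpow_neg ha hq0 hq1 j]
  have hb0 : ∀ j : ℕ, 0 < a * q ^ (-(j : ℤ)) / 2 := fun j => by positivity
  have hF : ∀ (j : ℕ) (x : ℝ), Real.exp (a / 2 * x) * (c j * Real.exp (-(a * q ^ (-(j : ℤ)) * x))) =
      c j * Real.exp (-((a * q ^ (-(j : ℤ)) - a / 2) * x)) := fun j x => by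
    rw [mul_left_comm, ← Real.exp_add]
    ring_nf
  have hint : ∀ j : ℕ, IntegrableOn
      (fun x => Real.exp (-((a * q ^ (-(j : ℤ)) - a / 2) * x))) (Ioi 0) := fun j => by
    simpa using (integrableOn_pow_mul_exp_neg_mul 0 ((hb0 j).trans_le (hb j))).1
  have hcont : ContinuousOn (fun x => Real.exp (a / 2 * x) *
      ∑' j : ℕ, c j * Real.exp (-(a * q ^ (-(j : ℤ)) * x))) (Ioi 0) :=
    ContinuousOn.mul (by fun_prop) (continuousOn_tsum_mul_exp_neg_zpow ha hq0 hq1 hK)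
  have hmeas := hcont.aestronglyMeasurable (μ := volume) measurableSet_Ioi
  simp_rw [← tsum_mul_left, hF] at hmeas ⊢
  refine integrable_tsum_of_summable_integral_norm (fun j => (hint j).const_mul (c j)) ?_ hmeas
  refine Summable.of_nonneg_of_le (fun j => integral_nonneg fun _ => norm_nonneg _) (fun j => ?_)
    ((summable_geometric_of_lt_one hq0.le hq1).mul_left (K * (2 / a)))
  simp_rw [norm_mul, Real.norm_eq_abs, Real.abs_exp]
  have hval := (integrableOn_pow_mul_exp_neg_mul 0 ((hb0 j).trans_le (hb j))).2
  simp only [pow_zero, one_mul, Nat.factorial_zero, Nat.cast_one, zero_add, pow_one] at hval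
  rw [integral_const_mul, hval]
  calc |c j| * (1 / (a * q ^ (-(j : ℤ)) - a / 2)) ≤ K * (1 / (a * q ^ (-(j : ℤ)) / 2)) :=
        mul_le_mul (hK j) (one_div_le_one_div_of_le (hb0 j) (hb j))
          (one_div_nonneg.2 ((hb0 j).le.trans (hb j))) hK0
    _ = K * (2 / a) * q ^ j := by
        rw [zpow_neg, zpow_natCast]
        field_simp

theorem integral_pow_mul_tsum (ha : 0 < a) (hq0 : 0 < q) (hq1 : q < 1)
    (hK : ∀ j, |c j| ≤ K) (n : ℕ) :
    ∫ x in Ioi (0 : ℝ), x ^ n * ∑' j : ℕ, c j * Real.exp (-(a * q ^ (-(j : ℤ)) * x)) =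
      n.factorial / a ^ (n + 1) * ∑' j, c j * (q ^ (n + 1)) ^ j := by
  have hK0 : 0 ≤ K := (abs_nonneg _).trans (hK 0)
  have hb : ∀ j : ℕ, 0 < a * q ^ (-(j : ℤ)) := fun j => by positivity
  have hval : ∀ j : ℕ, (n.factorial : ℝ) / (a * q ^ (-(j : ℤ))) ^ (n + 1) =
      n.factorial / a ^ (n + 1) * (q ^ (n + 1)) ^ j := fun j => by
    rw [zpow_neg, zpow_natCast, mul_pow, inv_pow, ← pow_mul, ← pow_mul, mul_comm j]
    field_simp
  have hi := fun j => integrableOn_pow_mul_exp_neg_mul n (hb j)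
  simp_rw [hval] at hi
  have hz : q ^ (n + 1) < 1 := pow_lt_one₀ hq0.le hq1 (by omega)
  have hz0 : 0 < q ^ (n + 1) := by positivity
  simp_rw [← tsum_mul_left, mul_left_comm _ (c _)]
  rw [← integral_tsum_of_summable_integral_norm (fun j => (hi j).1.const_mul (c j))]
  · simp_rw [integral_const_mul, (hi _).2]
  · refine Summable.of_nonneg_of_le (fun j => integral_nonneg fun _ => norm_nonneg _) (fun j => ?_)
      ((summable_geometric_of_lt_one hz0.le hz).mul_left (K * (n.factorial / a ^ (n + 1))))
    have hn : ∫ x in Ioi (0 : ℝ), ‖c j * (x ^ n * Real.exp (-(a * q ^ (-(j : ℤ)) * x)))‖ =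
        ∫ x in Ioi (0 : ℝ), |c j| * (x ^ n * Real.exp (-(a * q ^ (-(j : ℤ)) * x))) :=
      setIntegral_congr_fun measurableSet_Ioi fun x hx => by
        have : (0 : ℝ) ≤ x ^ n * Real.exp (-(a * q ^ (-(j : ℤ)) * x)) :=
          mul_nonneg (pow_nonneg (le_of_lt hx) _) (Real.exp_nonneg _)
        simp only [norm_mul (c j), Real.norm_eq_abs, abs_of_nonneg this]
    rw [hn, integral_const_mul, (hi j).2, mul_assoc K]
    exact mul_le_mul_of_nonneg_right (hK j) (by positivity)

end ExponentialSeries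

/-! ### Finite measures with exponential moments are determined by their moments -/

/-- Two finite measures on `ℝ` which have exponential moments and the same moments are equal. -/
theorem MeasureTheory.Measure.ext_of_forall_integral_pow_eq {μ ν : Measure ℝ} [IsFiniteMeasure μ]
    [IsFiniteMeasure ν] (hμ : 0 ∈ interior (integrableExpSet id μ))
    (hν : 0 ∈ interior (integrableExpSet id ν)) (h : ∀ n : ℕ, ∫ x, x ^ n ∂μ = ∫ x, x ^ n ∂ν) :
    μ = ν := by
  -- `V` is a vertical strip around the imaginary axis on which both complex moment generating
  -- functions are analytic.
  set U : Set ℝ := interior (integrableExpSet id μ) ∩ interior (integrableExpSet id ν) with hU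
  set V : Set ℂ := {z | z.re ∈ U} with hV
  have hconv : Convex ℝ U := convex_integrableExpSet.interior.inter convex_integrableExpSet.interior
  have hVpre : IsPreconnected V := (hconv.linear_preimage Complex.reLm).isPreconnected
  have aμ : AnalyticOnNhd ℂ (complexMGF id μ) V := analyticOnNhd_complexMGF.mono fun z hz => hz.1
  have aν : AnalyticOnNhd ℂ (complexMGF id ν) V := analyticOnNhd_complexMGF.mono fun z hz => hz.2
  have h0V : (0 : ℂ) ∈ V := ⟨by simpa using hμ, by simpa using hν⟩
  -- The derivatives at `0` are the moments, so the difference vanishes to infinite order there.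
  have hnear : complexMGF id μ =ᶠ[𝓝 0] complexMGF id ν := by
    have hsub : AnalyticAt ℂ (complexMGF id μ - complexMGF id ν) 0 := (aμ 0 h0V).sub (aν 0 h0V)
    have htop : analyticOrderAt (complexMGF id μ - complexMGF id ν) 0 = ⊤ := by
      refine ENat.eq_top_iff_forall_ge.2 fun n => ?_
      refine (natCast_le_analyticOrderAt_iff_iteratedDeriv_eq_zero hsub).2 fun i _ => ?_
      rw [iteratedDeriv_sub (aμ 0 h0V).contDiffAt (aν 0 h0V).contDiffAt,
        iteratedDeriv_complexMGF (by simpa using hμ), iteratedDeriv_complexMGF (by simpa using hν)]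
      have e : ∀ ρ : Measure ℝ, ∫ x : ℝ, ((id x : ℝ) : ℂ) ^ i * Complex.exp (0 * ((id x : ℝ) : ℂ)) ∂ρ
          = ((∫ x, x ^ i ∂ρ : ℝ) : ℂ) := fun ρ => by
        rw [← integral_complex_ofReal]
        simp
      rw [e, e, h i, sub_self]
    filter_upwards [analyticOrderAt_eq_top.1 htop] with z hz
    exact sub_eq_zero.1 hz
  have heq := aμ.eqOn_of_preconnected_of_eventuallyEq aν hVpre h0V hnear
  refine Measure.ext_of_charFun (funext fun t => ?_)
  rw [← complexMGF_id_mul_I, ← complexMGF_id_mul_I]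
  exact heq ⟨by simpa using hμ, by simpa using hν⟩

/-- If `e^{uX}` is integrable for some `u > 0` and the measure is finite and carried by the
nonnegative reals, then `0` is interior to the set of exponents of integrability. -/
theorem zero_mem_interior_integrableExpSet {μ : Measure ℝ} [IsFiniteMeasure μ]
    (hμ : ∀ᵐ x ∂μ, 0 ≤ x) {u : ℝ} (hu : 0 < u) (h : Integrable (fun x => Real.exp (u * x)) μ) :
    0 ∈ interior (integrableExpSet id μ) := by
  refine mem_interior.2 ⟨Iio u, fun t ht => ?_, isOpen_Iio, hu⟩
  refine h.mono' (by fun_prop) ?_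
  filter_upwards [hμ] with x hx
  rw [Real.norm_eq_abs, Real.abs_exp]
  exact Real.exp_le_exp.2 (mul_le_mul_of_nonneg_right (le_of_lt ht) hx)

/-! ### The generating function of a compound Poisson sum -/

section CompoundPoisson

variable {Ω : Type*} [MeasurableSpace Ω] {P : Measure Ω}

theorem lintegral_pow_poissonMeasure (s : ℝ≥0) {f : ℝ} (hf : 0 ≤ f) :
    ∫⁻ n, ENNReal.ofReal f ^ n ∂(poissonMeasure s) =
      ENNReal.ofReal (Real.exp (-(s * (1 - f)))) := by
  have hterm : ∀ n : ℕ, ENNReal.ofReal f ^ n * poissonMeasure s {n} =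
      ENNReal.ofReal (Real.exp (-s) * ((s * f) ^ n / n.factorial)) := fun n => by
    rw [poissonMeasure_singleton, ← ENNReal.ofReal_pow hf, ← ENNReal.ofReal_mul (by positivity)]
    congr 1
    rw [mul_pow]
    ring
  have hsum : HasSum (fun n : ℕ => Real.exp (-s) * ((s * f) ^ n / n.factorial))
      (Real.exp (-s) * Real.exp (s * f)) := by
    rw [Real.exp_eq_exp_ℝ]
    exact (NormedSpace.expSeries_div_hasSum_exp ((s : ℝ) * f)).mul_left _
  rw [lintegral_countable', tsum_congr hterm,
    ← ENNReal.ofReal_tsum_of_nonneg (fun n => by positivity) hsum.summable, hsum.tsum_eq,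
    ← Real.exp_add]
  ring_nf

theorem lintegral_pow_sum_range [IsProbabilityMeasure P] {Z : ℕ → Ω → ℕ}
    (hZ : ∀ i, Measurable (Z i)) (hindep : iIndepFun Z P)
    (hident : ∀ i, IdentDistrib (Z i) (Z 0) P P) (z : ℝ≥0∞) (n : ℕ) :
    ∫⁻ ω, z ^ (∑ i ∈ Finset.range n, Z i ω) ∂P = (∫⁻ ω, z ^ Z 0 ω ∂P) ^ n := by
  have hmeas : Measurable fun k : ℕ => z ^ k := measurable_of_countable _
  have h1 : ∀ i, ∫⁻ ω, z ^ Z i ω ∂P = ∫⁻ ω, z ^ Z 0 ω ∂P := fun i =>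
    ((hident i).comp hmeas).lintegral_eq
  simp_rw [← Finset.prod_pow_eq_pow_sum]
  rw [lintegral_prod_eq_prod_lintegral_of_indepFun (Finset.range n) (fun i ω => z ^ Z i ω)
    (hindep.comp (fun _ k => z ^ k) fun _ => hmeas) fun i => hmeas.comp (hZ i)]
  simp [h1]

/-- The generating function of a compound Poisson sum. -/
theorem lintegral_pow_compoundSum [IsProbabilityMeasure P] {N : ℝ≥0 → Ω → ℕ} {Z : ℕ → Ω → ℕ}
    {r : ℝ≥0} (hNZ : IsCompoundPoissonData N Z r P) (t : ℝ≥0) {z : ℝ} (hz0 : 0 ≤ z) (hz1 : z ≤ 1) :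
    ∫⁻ ω, ENNReal.ofReal z ^ compoundSum N Z t ω ∂P =
      ENNReal.ofReal (Real.exp (-(r * t * (1 - ∫ ω, z ^ Z 0 ω ∂P)))) := by
  -- As a function of the pair `(N_t, Z)`, whose law is a product, the compound sum can be
  -- integrated first over `Z` with the count fixed.
  set F : ℕ × (ℕ → ℕ) → ℝ≥0∞ := fun x => ENNReal.ofReal z ^ (∑ i ∈ Finset.range x.1, x.2 i) with hF
  have hFm : Measurable F := by
    refine measurable_from_prod_countable_right fun n => ?_
    have : Measurable fun y : ℕ → ℕ => ∑ i ∈ Finset.range n, y i := by fun_prop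
    exact (measurable_of_countable fun k : ℕ => ENNReal.ofReal z ^ k).comp this
  have hlaw := hNZ.poisson.hasLaw t
  have hZm : Measurable fun ω i => Z i ω := measurable_pi_lambda _ hNZ.measurable_jumps
  have hind : IndepFun (N t) (fun ω i => Z i ω) P :=
    hNZ.indep.comp (measurable_pi_apply t) measurable_id
  have hmap := (indepFun_iff_map_prod_eq_prod_map_map hlaw.aemeasurable hZm.aemeasurable).1 hind
  have hprob : IsProbabilityMeasure (P.map fun ω i => Z i ω) :=
    Measure.isProbabilityMeasure_map hZm.aemeasurable
  have hint : Integrable (fun ω => z ^ Z 0 ω) P := by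
    refine Integrable.of_bound ((measurable_of_countable fun k : ℕ => z ^ k).comp
      (hNZ.measurable_jumps 0)).aestronglyMeasurable 1 (Eventually.of_forall fun ω => ?_)
    rw [Real.norm_of_nonneg (pow_nonneg hz0 _)]
    exact pow_le_one₀ hz0 hz1
  have hone : ∫⁻ ω, ENNReal.ofReal z ^ Z 0 ω ∂P = ENNReal.ofReal (∫ ω, z ^ Z 0 ω ∂P) := by
    rw [ofReal_integral_eq_lintegral_ofReal hint (Eventually.of_forall fun _ => pow_nonneg hz0 _)]
    simp_rw [ENNReal.ofReal_pow hz0]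
  calc ∫⁻ ω, ENNReal.ofReal z ^ compoundSum N Z t ω ∂P
      = ∫⁻ x, F x ∂(P.map fun ω => (N t ω, fun i => Z i ω)) := by
        rw [lintegral_map' hFm.aemeasurable (hlaw.aemeasurable.prodMk hZm.aemeasurable)]
        rfl
    _ = ∫⁻ n, ∫⁻ y, F (n, y) ∂(P.map fun ω i => Z i ω) ∂(poissonMeasure (r * t)) := by
        rw [hmap, hlaw.map_eq, lintegral_prod _ hFm.aemeasurable]
    _ = ∫⁻ n, ENNReal.ofReal (∫ ω, z ^ Z 0 ω ∂P) ^ n ∂(poissonMeasure (r * t)) := by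
        refine lintegral_congr fun n => ?_
        rw [lintegral_map (f := fun y => F (n, y)) (hFm.comp measurable_prodMk_left) hZm, ← hone,
          ← lintegral_pow_sum_range hNZ.measurable_jumps hNZ.indep_jumps hNZ.identDistrib_jumps]
    _ = _ := by
        rw [lintegral_pow_poissonMeasure _ (integral_nonneg fun ω => pow_nonneg hz0 _)]
        push_cast
        rfl

/-- The masses of the positive values of a nonnegative integer random variable. -/
theorem hasSum_measureReal_eq_succ [IsProbabilityMeasure P] {Y : Ω → ℕ} (hY : Measurable Y) :
    HasSum (fun k => P.real {ω | Y ω = k + 1}) (P.real {ω | 1 ≤ Y ω}) := by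
  have hU : {ω | 1 ≤ Y ω} = ⋃ k : ℕ, {ω | Y ω = k + 1} := by
    ext ω
    simp only [mem_ofPred_eq, mem_iUnion]
    exact ⟨fun h => ⟨Y ω - 1, by omega⟩, fun ⟨k, hk⟩ => by omega⟩
  have hms : ∀ k : ℕ, MeasurableSet {ω | Y ω = k} := fun k => hY (measurableSet_singleton k)
  have hd : Pairwise (Function.onFun Disjoint fun k : ℕ => {ω | Y ω = k + 1}) := fun i j hij =>
    Set.disjoint_left.2 fun ω hi hj => hij (by
      simp only [mem_ofPred_eq] at hi hj
      omega)
  have hm := measure_iUnion (μ := P) hd fun k => hms (k + 1)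
  rw [hU, measureReal_def, hm, ENNReal.tsum_toReal_eq fun k => measure_ne_top P _]
  exact ENNReal.hasSum_toReal (hm ▸ measure_ne_top P _)

/-- The atom at `0` cancels: jumps of size zero affect the law of the sum only through `m`. This
turns the exponent into `Φ`. -/
theorem one_sub_integral_pow [IsProbabilityMeasure P] {Y : Ω → ℕ} (hY : Measurable Y) {z : ℝ}
    (hz0 : 0 ≤ z) (hz1 : z ≤ 1) :
    1 - ∫ ω, z ^ Y ω ∂P =
      P.real {ω | 1 ≤ Y ω} - ∑' k : ℕ, P.real {ω | Y ω = k + 1} * z ^ (k + 1) := by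
  have hprob : IsProbabilityMeasure (P.map Y) := Measure.isProbabilityMeasure_map hY.aemeasurable
  have hint : Integrable (fun k : ℕ => z ^ k) (P.map Y) :=
    Integrable.of_bound (measurable_of_countable _).aestronglyMeasurable 1
      (Eventually.of_forall fun k => by
        rw [Real.norm_of_nonneg (pow_nonneg hz0 _)]
        exact pow_le_one₀ hz0 hz1)
  have hms : ∀ k : ℕ, (P.map Y).real {k} = P.real {ω | Y ω = k} := fun k => by
    rw [map_measureReal_apply hY (measurableSet_singleton k)]
    rfl
  have hs := hasSum_measureReal_eq_succ (P := P) hY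
  have hle : ∀ k : ℕ, P.real {ω | Y ω = k + 1} * z ^ (k + 1) ≤ P.real {ω | Y ω = k + 1} := fun k =>
    mul_le_of_le_one_right measureReal_nonneg (pow_le_one₀ hz0 hz1)
  have hsum : Summable fun k : ℕ => P.real {ω | Y ω = k} * z ^ k :=
    (summable_nat_add_iff 1).1 (Summable.of_nonneg_of_le (fun k => by positivity) hle hs.summable)
  have e : ∫ ω, z ^ Y ω ∂P = ∑' k : ℕ, P.real {ω | Y ω = k} * z ^ k := by
    rw [← integral_map hY.aemeasurable hint.1, integral_countable hint]
    exact tsum_congr fun k => by rw [hms, smul_eq_mul]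
  have h0 : P.real {ω | Y ω = 0} + P.real {ω | 1 ≤ Y ω} = 1 := by
    have : {ω | 1 ≤ Y ω} = {ω | Y ω = 0}ᶜ := by
      ext ω
      simp only [mem_ofPred_eq, mem_compl_iff]
      omega
    rw [this]
    exact probReal_add_probReal_compl (s := {ω | Y ω = 0}) (hY (measurableSet_singleton 0))
  rw [e, hsum.tsum_eq_zero_add, pow_zero, mul_one]
  linarith

end CompoundPoisson

/-! ### Powers of the integral of a right-continuous function -/

section PowIntegral

/-- The tail `F(t) = ∫_t^∞ f` has right derivative `-f`, so `F^{n+1}` has right derivative `-(n+1) f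
F^n`. The fundamental theorem for right derivatives on `[0, T]` and `T → ∞` conclude;
right-continuity of `f` is all it needs. -/
theorem pow_integral_Ioi_eq {f : ℝ → ℝ} (hf0 : ∀ t, 0 ≤ f t) (hf : IntegrableOn f (Ioi 0))
    (hc : ∀ t, 0 < t → ContinuousWithinAt f (Ioi t) t) (n : ℕ) :
    IntegrableOn (fun t => f t * (∫ u in Ioi t, f u) ^ n) (Ioi 0) ∧
    (∫ t in Ioi 0, f t) ^ (n + 1) = (n + 1) * ∫ t in Ioi 0, f t * (∫ u in Ioi t, f u) ^ n := by
  set A := ∫ t in Ioi 0, f t with hA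
  set F : ℝ → ℝ := fun t => ∫ u in Ioi t, f u with hF
  have hii : ∀ T : ℝ, 0 ≤ T → IntervalIntegrable f volume 0 T := fun T hT =>
    (intervalIntegrable_iff_integrableOn_Ioc_of_le hT).2 (hf.mono_set Ioc_subset_Ioi_self)
  have hFeq : ∀ t, 0 ≤ t → F t = A - ∫ u in (0 : ℝ)..t, f u := fun t ht => by
    rw [eq_sub_iff_add_eq', hA, hF]
    exact intervalIntegral.integral_interval_add_Ioi hf (hf.mono_set (Ioi_subset_Ioi ht))
  have hF0 : ∀ t, 0 ≤ F t := fun t => integral_nonneg fun u => hf0 u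
  have hFA : ∀ t, 0 ≤ t → F t ≤ A := fun t ht => by
    rw [hFeq t ht, sub_le_self_iff]
    exact intervalIntegral.integral_nonneg ht fun u _ => hf0 u
  have hcont : ContinuousOn F (Ici 0) := by
    have h : ContinuousOn (fun t => A - ∫ u in (0 : ℝ)..t, f u) (Ici 0) := by
      refine continuousOn_const.sub fun t ht => ?_
      have h1 := intervalIntegral.continuousOn_primitive_interval' (μ := volume)
        (hii (t + 1) (by linarith [mem_Ici.1 ht])) left_mem_uIcc
      rw [uIcc_of_le (by linarith [mem_Ici.1 ht])] at h1
      refine (h1 t ⟨ht, by linarith⟩).mono_of_mem_nhdsWithin ?_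
      exact mem_nhdsWithin.2 ⟨Iio (t + 1), isOpen_Iio, by simp, fun x hx => ⟨hx.2, le_of_lt hx.1⟩⟩
    exact h.congr fun t ht => hFeq t ht
  have hderiv : ∀ t, 0 < t → HasDerivWithinAt F (-f t) (Ioi t) t := fun t ht => by
    have hm : StronglyMeasurableAtFilter f (𝓝[Ioi t] t) :=
      ⟨Ioi t, self_mem_nhdsWithin, (hf.mono_set (Ioi_subset_Ioi ht.le)).1⟩
    have h1 : HasDerivWithinAt (fun u => ∫ x in (0 : ℝ)..u, f x) (f t) (Ici t) t :=
      intervalIntegral.integral_hasDerivWithinAt_right (hii t ht.le) hm (hc t ht)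
    have h2 := (h1.mono Ioi_subset_Ici_self).const_sub A
    refine h2.congr (fun u hu => hFeq u (ht.le.trans (le_of_lt hu))) (hFeq t ht.le)
  have hint : IntegrableOn (fun t => f t * F t ^ n) (Ioi 0) := by
    refine Integrable.mono' (hf.mul_const (A ^ n)) ?_ ?_
    · exact hf.1.mul (((hcont.mono Ioi_subset_Ici_self).pow n).aestronglyMeasurable
        measurableSet_Ioi)
    · filter_upwards [ae_restrict_mem measurableSet_Ioi] with t ht
      rw [Real.norm_of_nonneg (mul_nonneg (hf0 t) (pow_nonneg (hF0 t) n))]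
      exact mul_le_mul_of_nonneg_left (pow_le_pow_left₀ (hF0 t) (hFA t (le_of_lt ht)) n) (hf0 t)
  refine ⟨hint, ?_⟩
  have hfin : ∀ T : ℝ, 0 ≤ T →
      ∫ t in (0 : ℝ)..T, f t * F t ^ n = (A ^ (n + 1) - F T ^ (n + 1)) / (n + 1) := by
    intro T hT
    have h1 := intervalIntegral.integral_eq_sub_of_hasDeriv_right (f := fun t => F t ^ (n + 1))
      (f' := fun t => ((n + 1 : ℕ) : ℝ) * F t ^ n * -f t) (a := 0) (b := T)
      ((hcont.mono (by rw [uIcc_of_le hT]; exact Icc_subset_Ici_self)).pow (n + 1))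
      (fun t ht => by
        rw [min_eq_left hT] at ht
        simpa using (hderiv t ht.1).fun_pow (n + 1)) ?_
    · have h2 : ∀ t, ((n + 1 : ℕ) : ℝ) * F t ^ n * -f t = -(n + 1) * (f t * F t ^ n) := fun t => by
        push_cast; ring
      simp_rw [h2] at h1
      rw [intervalIntegral.integral_const_mul] at h1
      have h3 : F 0 = A := rfl
      rw [h3] at h1
      have hn : (n : ℝ) + 1 ≠ 0 := by positivity
      rw [eq_div_iff hn]
      linarith
    · rw [intervalIntegrable_iff_integrableOn_Ioc_of_le hT]
      refine (IntegrableOn.mono_set (hint.const_mul (-(n + 1 : ℝ))) Ioc_subset_Ioi_self).congr_fun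
        (fun t _ => ?_) measurableSet_Ioc
      push_cast
      ring
  have hFlim : Tendsto F atTop (𝓝 0) := by
    have h := (intervalIntegral_tendsto_integral_Ioi 0 hf tendsto_id).const_sub A
    rw [← hA, sub_self] at h
    refine h.congr' ?_
    filter_upwards [eventually_ge_atTop 0] with t ht using (hFeq t ht).symm
  have l1 := intervalIntegral_tendsto_integral_Ioi 0 hint tendsto_id
  have l2 : Tendsto (fun T => (A ^ (n + 1) - F T ^ (n + 1)) / (n + 1)) atTop
      (𝓝 (A ^ (n + 1) / (n + 1))) := by
    simpa using ((hFlim.pow (n + 1)).const_sub (A ^ (n + 1))).div_const ((n : ℝ) + 1)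
  have l3 := l2.congr' (by
    filter_upwards [eventually_ge_atTop 0] with T hT using (hfin T hT).symm)
  rw [tendsto_nhds_unique l1 l3]
  have hn : (n : ℝ) + 1 ≠ 0 := by positivity
  field_simp

theorem pow_lintegral_Ioi_eq {f : ℝ → ℝ≥0∞} (hm : Measurable f)
    (hf : ∫⁻ t in Ioi 0, f t ≠ ∞) (hft : ∀ t, f t ≠ ∞)
    (hc : ∀ t, 0 < t → ContinuousWithinAt f (Ioi t) t) (n : ℕ) :
    (∫⁻ t in Ioi 0, f t) ^ (n + 1) =
      (n + 1) * ∫⁻ t in Ioi 0, f t * (∫⁻ u in Ioi t, f u) ^ n := by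
  have hg : ∀ t, ENNReal.ofReal (f t).toReal = f t := fun t => ENNReal.ofReal_toReal (hft t)
  have hg0 : ∀ t, 0 ≤ (f t).toReal := fun t => ENNReal.toReal_nonneg
  have hgi : IntegrableOn (fun t => (f t).toReal) (Ioi 0) :=
    integrable_toReal_of_lintegral_ne_top hm.aemeasurable hf
  have hlin : ∀ t, 0 ≤ t → ∫⁻ u in Ioi t, f u = ENNReal.ofReal (∫ u in Ioi t, (f u).toReal) :=
    fun t ht => by
      rw [ofReal_integral_eq_lintegral_ofReal (hgi.mono_set (Ioi_subset_Ioi ht))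
        (Eventually.of_forall hg0)]
      simp_rw [hg]
  obtain ⟨h1, h2⟩ := pow_integral_Ioi_eq hg0 hgi (fun t ht =>
    (ENNReal.tendsto_toReal (hft t)).comp (hc t ht)) n
  have hF0 : ∀ t, 0 ≤ ∫ u in Ioi t, (f u).toReal := fun t => integral_nonneg hg0
  have e : ∫⁻ t in Ioi 0, f t * (∫⁻ u in Ioi t, f u) ^ n =
      ENNReal.ofReal (∫ t in Ioi 0, (f t).toReal * (∫ u in Ioi t, (f u).toReal) ^ n) := by
    rw [ofReal_integral_eq_lintegral_ofReal h1
      (Eventually.of_forall fun t => mul_nonneg (hg0 t) (pow_nonneg (hF0 t) n))]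
    refine setLIntegral_congr_fun measurableSet_Ioi fun t ht => ?_
    rw [ENNReal.ofReal_mul (hg0 t), hg, ENNReal.ofReal_pow (hF0 t), hlin t (le_of_lt ht)]
  rw [e, hlin 0 le_rfl, ← ENNReal.ofReal_pow (hF0 0), h2, ENNReal.ofReal_mul (by positivity)]
  congr 1
  rw [ENNReal.ofReal_add (by positivity) zero_le_one]
  simp

end PowIntegral

/-! ### Regular versions of integer-valued subordinators -/

section Regular

variable {Ω : Type*} [MeasurableSpace Ω] {P : Measure Ω}

/-- An integer-valued subordinator all of whose paths are regular. -/
structure IsRegularSubordinator (S : ℝ≥0 → Ω → ℕ) (P : Measure Ω) : Prop where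
  measurable : ∀ t, Measurable (S t)
  zero : ∀ ω, S 0 ω = 0
  indep_increments : HasIndepIncrements (fun t ω => (S t ω : ℝ)) P
  stationary_increments :
    ∀ s h : ℝ≥0, IdentDistrib (fun ω => (S (s + h) ω : ℝ) - S s ω) (fun ω => (S h ω : ℝ)) P P
  mono : ∀ ω, Monotone fun t => S t ω
  eventually_eq : ∀ ω t, ∀ᶠ s in 𝓝[≥] t, S s ω = S t ω

theorem IsIntegerValuedSubordinator.measurable_apply {S : ℝ≥0 → Ω → ℕ}
    (hS : IsIntegerValuedSubordinator S P) (t : ℝ≥0) : Measurable (S t) := by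
  have h := Nat.measurable_floor.comp (hS.measurable t)
  simpa [Function.comp_def] using h

/-- Setting the paths to `0` off a measurable set of full measure leaves the laws of the increments
unchanged. -/
theorem IsIntegerValuedSubordinator.exists_regular {S : ℝ≥0 → Ω → ℕ}
    (hS : IsIntegerValuedSubordinator S P) :
    ∃ S' : ℝ≥0 → Ω → ℕ, IsRegularSubordinator S' P ∧ ∀ᵐ ω ∂P, ∀ t, S' t ω = S t ω := by
  classical
  obtain ⟨G, hG, hGm, hGs⟩ := Eventually.exists_measurable_mem
    (hS.zero.and (hS.monotone_paths.and hS.rightContinuous_paths))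
  set S' : ℝ≥0 → Ω → ℕ := fun t => G.indicator (S t) with hS'
  have hin : ∀ ω ∈ G, ∀ t, S' t ω = S t ω := fun ω hω t => indicator_of_mem hω _
  have hout : ∀ ω ∉ G, ∀ t, S' t ω = 0 := fun ω hω t => indicator_of_notMem hω _
  have hae : ∀ᵐ ω ∂P, ∀ t, S' t ω = S t ω := by
    filter_upwards [hG] with ω hω using hin ω hω
  refine ⟨S', ⟨fun t => (hS.measurable_apply t).indicator hGm, fun ω => ?_, fun n t ht => ?_,
    fun s h => ?_, fun ω s t hst => ?_, fun ω t => ?_⟩, hae⟩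
  · by_cases hω : ω ∈ G
    · rw [hin ω hω]
      exact_mod_cast (hGs ω hω).1
    · exact hout ω hω 0
  · refine (hS.indep_increments n t ht).congr fun i => ?_
    filter_upwards [hae] with ω hω
    simp only [hω]
  · refine IdentDistrib.trans (IdentDistrib.of_ae_eq ?_ ?_)
      ((hS.stationary_increments s h).trans (IdentDistrib.of_ae_eq ?_ ?_))
    · have m : ∀ t, Measurable (S' t) := fun t => (hS.measurable_apply t).indicator hGm
      exact (((measurable_of_countable fun k : ℕ => (k : ℝ)).comp (m _)).sub
        ((measurable_of_countable fun k : ℕ => (k : ℝ)).comp (m _))).aemeasurable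
    · filter_upwards [hae] with ω hω
      simp only [hω]
    · exact (hS.measurable h).aemeasurable
    · filter_upwards [hae] with ω hω
      simp only [hω]
  · by_cases hω : ω ∈ G
    · simp only [hin ω hω]
      have h : (S s ω : ℝ) ≤ S t ω := (hGs ω hω).2.1 hst
      exact_mod_cast h
    · simp only [hout ω hω, le_refl]
  · by_cases hω : ω ∈ G
    · simp only [hin ω hω]
      -- Integers at distance less than `1` are equal, so right-continuity means local constancy to
      -- the right.
      have h := (hGs ω hω).2.2 t (Metric.ball_mem_nhds _ one_pos)
      filter_upwards [h] with s hs
      have h1 : |(S s ω : ℝ) - S t ω| < 1 := hs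
      have h2 : |(S s ω : ℤ) - S t ω| < 1 := by exact_mod_cast h1
      have h3 := Int.abs_lt_one_iff.1 h2
      omega
    · simp [hout ω hω]

end Regular

/-! ### The Markov property along dyadic grids and the moment recursion -/

section Dyadic

/-- The index of the first point of the grid `2⁻ᵏ ℕ` to the right of `u`. -/
noncomputable def dyadicIndex (k : ℕ) (u : ℝ) : ℕ := ⌊2 ^ k * u.toNNReal⌋₊ + 1

theorem measurable_dyadicIndex (k : ℕ) : Measurable (dyadicIndex k) := by
  unfold dyadicIndex
  have h : Measurable fun u : ℝ => 2 ^ k * u.toNNReal := by fun_prop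
  exact (Nat.measurable_floor.comp h).add_const 1

theorem le_dyadicIndex_div (k : ℕ) (u : ℝ) : u.toNNReal ≤ dyadicIndex k u / 2 ^ k := by
  rw [le_div_iff₀ (by positivity), mul_comm]
  exact (Nat.lt_floor_add_one _).le.trans (by simp [dyadicIndex])

theorem dyadicIndex_div_le (k : ℕ) (u : ℝ) :
    (dyadicIndex k u : ℝ≥0) / 2 ^ k ≤ u.toNNReal + (1 / 2) ^ k := by
  rw [div_le_iff₀ (by positivity), add_mul, ← mul_pow]
  simp only [dyadicIndex, Nat.cast_add, Nat.cast_one]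
  rw [one_div, inv_mul_cancel₀ two_ne_zero, one_pow, mul_comm]
  gcongr
  exact Nat.floor_le (zero_le)

/-- The dyadic grids are nested. This is the source of the monotone convergence below. -/
theorem antitone_dyadicIndex_div (u : ℝ) :
    Antitone fun k : ℕ => (dyadicIndex k u : ℝ≥0) / 2 ^ k := by
  refine antitone_nat_of_succ_le fun k => ?_
  rw [div_le_div_iff₀ (by positivity) (by positivity), pow_succ, ← mul_assoc, mul_right_comm]
  gcongr
  have h : dyadicIndex (k + 1) u ≤ dyadicIndex k u * 2 := by
    have h1 : ⌊2 ^ (k + 1) * u.toNNReal⌋₊ < (⌊2 ^ k * u.toNNReal⌋₊ + 1) * 2 := by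
      rw [Nat.floor_lt (zero_le), pow_succ, mul_right_comm]
      push_cast
      have := Nat.lt_floor_add_one (2 ^ k * u.toNNReal)
      gcongr
    unfold dyadicIndex
    omega
  exact_mod_cast h

theorem tendsto_dyadicIndex_div (u : ℝ) :
    Tendsto (fun k : ℕ => (dyadicIndex k u : ℝ≥0) / 2 ^ k) atTop (𝓝 u.toNNReal) := by
  refine tendsto_of_tendsto_of_tendsto_of_le_of_le tendsto_const_nhds ?_
    (fun k => le_dyadicIndex_div k u) (fun k => dyadicIndex_div_le k u)
  have h : Tendsto (fun k : ℕ => (1 / 2 : ℝ≥0) ^ k) atTop (𝓝 0) :=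
    NNReal.tendsto_pow_atTop_nhds_zero_of_lt_one (by
      rw [one_div]; exact inv_lt_one_of_one_lt₀ one_lt_two)
  simpa using h.const_add u.toNNReal

variable {Q : ℝ≥0∞}

/-- The exponential functional of the step path on the grid `2⁻ᵏ ℕ` with increments `y`, which
bounds the exponential functional from below. -/
noncomputable def gridFunctional (Q : ℝ≥0∞) (k : ℕ) (y : ℕ → ℝ) : ℝ≥0∞ :=
  ∫⁻ u in Ioi (0 : ℝ), Q ^ ⌊∑ i ∈ Finset.range (dyadicIndex k u), y i⌋₊

theorem measurable_gridFunctional (Q : ℝ≥0∞) (k : ℕ) : Measurable (gridFunctional Q k) := by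
  have h1 : Measurable fun x : (ℕ → ℝ) × ℕ => Q ^ ⌊∑ i ∈ Finset.range x.2, x.1 i⌋₊ := by
    refine measurable_from_prod_countable_left fun n => ?_
    have : Measurable fun y : ℕ → ℝ => ∑ i ∈ Finset.range n, y i := by fun_prop
    exact (measurable_of_countable fun k : ℕ => Q ^ k).comp (Nat.measurable_floor.comp this)
  have h2 : Measurable fun x : (ℕ → ℝ) × ℝ => (x.1, dyadicIndex k x.2) :=
    measurable_fst.prodMk ((measurable_dyadicIndex k).comp measurable_snd)
  exact (h1.comp h2).lintegral_prod_right'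

theorem gridFunctional_increments {x : ℝ≥0 → ℕ} (hx : Monotone x) (t : ℝ≥0) (k : ℕ) :
    gridFunctional Q k (fun i => (x (t + ((i + 1 : ℕ) : ℝ≥0) / 2 ^ k) : ℝ) -
      x (t + (i : ℝ≥0) / 2 ^ k)) =
      ∫⁻ u in Ioi (0 : ℝ), Q ^ (x (t + (dyadicIndex k u : ℝ≥0) / 2 ^ k) - x t) := by
  refine lintegral_congr fun u => ?_
  rw [Finset.sum_range_sub fun i : ℕ => (x (t + (i : ℝ≥0) / 2 ^ k) : ℝ)]
  simp only [Nat.cast_zero, zero_div, add_zero]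
  rw [← Nat.cast_sub (hx le_self_add), Nat.floor_natCast]

/-- Grid points decrease to `u` and `Q ≤ 1`, so the integrands increase, and they are eventually
constant in `k`. The functional of the path after `t` thus becomes a monotone limit of functionals
of countably many increments. -/
theorem gridFunctional_monotone_tendsto (hQ : Q ≤ 1) {x : ℝ≥0 → ℕ} (hx : Monotone x)
    (hc : ∀ t, ∀ᶠ s in 𝓝[≥] t, x s = x t) (t : ℝ≥0) :
    (Monotone fun k : ℕ => gridFunctional Q k (fun i =>
      (x (t + ((i + 1 : ℕ) : ℝ≥0) / 2 ^ k) : ℝ) - x (t + (i : ℝ≥0) / 2 ^ k))) ∧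
    Tendsto (fun k : ℕ => gridFunctional Q k (fun i =>
      (x (t + ((i + 1 : ℕ) : ℝ≥0) / 2 ^ k) : ℝ) - x (t + (i : ℝ≥0) / 2 ^ k))) atTop
      (𝓝 (∫⁻ u in Ioi (0 : ℝ), Q ^ (x (t + u.toNNReal) - x t))) := by
  simp_rw [gridFunctional_increments hx]
  have hmono : ∀ u : ℝ, Monotone fun k : ℕ =>
      Q ^ (x (t + (dyadicIndex k u : ℝ≥0) / 2 ^ k) - x t) := fun u k l hkl =>
    pow_le_pow_right_of_le_one' hQ (Nat.sub_le_sub_right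
      (hx (add_le_add_right (antitone_dyadicIndex_div u hkl) t)) _)
  refine ⟨fun k l hkl => lintegral_mono fun u => hmono u hkl,
    lintegral_tendsto_of_tendsto_of_monotone (fun k => ?_) (Eventually.of_forall hmono)
      (Eventually.of_forall fun u => ?_)⟩
  · exact ((measurable_of_countable fun n : ℕ =>
      Q ^ (x (t + (n : ℝ≥0) / 2 ^ k) - x t)).comp (measurable_dyadicIndex k)).aemeasurable
  · have h : Tendsto (fun k : ℕ => t + (dyadicIndex k u : ℝ≥0) / 2 ^ k) atTop
        (𝓝[≥] (t + u.toNNReal)) :=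
      tendsto_nhdsWithin_iff.2 ⟨(tendsto_dyadicIndex_div u).const_add t,
        Eventually.of_forall fun k => add_le_add_right (le_dyadicIndex_div k u) t⟩
    refine tendsto_const_nhds.congr' ?_
    filter_upwards [h.eventually (hc (t + u.toNNReal))] with k hk
    rw [hk]

theorem setLIntegral_Ioi_comp_toNNReal (g : ℝ≥0 → ℝ≥0∞) (t : ℝ≥0) :
    ∫⁻ u in Ioi (t : ℝ), g u.toNNReal = ∫⁻ u in Ioi (0 : ℝ), g (t + u.toNNReal) := by
  rw [← lintegral_indicator measurableSet_Ioi, ← lintegral_indicator measurableSet_Ioi,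
    ← lintegral_add_left_eq_self _ (t : ℝ)]
  refine lintegral_congr fun u => ?_
  by_cases hu : 0 < u
  · rw [indicator_of_mem (by simpa using hu), indicator_of_mem (by simpa using hu),
      Real.toNNReal_add t.coe_nonneg hu.le, Real.toNNReal_coe]
  · rw [indicator_of_notMem (by simpa using hu), indicator_of_notMem (by simpa using hu)]

end Dyadic

namespace IsRegularSubordinator

variable {Ω : Type*} [MeasurableSpace Ω] {P : Measure Ω} {S : ℝ≥0 → Ω → ℕ} {Q : ℝ≥0∞}

theorem measurable_cast (hS : IsRegularSubordinator S P) (t : ℝ≥0) :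
    Measurable fun ω => (S t ω : ℝ) :=
  (measurable_of_countable fun k : ℕ => (k : ℝ)).comp (hS.measurable t)

theorem indepFun_increments (hS : IsRegularSubordinator S P) [IsProbabilityMeasure P]
    (t h : ℝ≥0) :
    IndepFun (fun ω => (S t ω : ℝ))
      (fun ω (i : ℕ) => (S (t + ((i + 1 : ℕ) : ℝ≥0) / h) ω : ℝ) - S (t + (i : ℝ≥0) / h) ω) P := by
  -- Prepending time `0` makes `S_t` itself the increment of index `0`, as `S_0 = 0`.
  let τ : ℕ → ℝ≥0 := fun i => Nat.casesOn i 0 fun i => t + (i : ℝ≥0) / h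
  have hτ : Monotone τ := by
    refine monotone_nat_of_le_succ fun i => ?_
    cases i with
    | zero => exact zero_le
    | succ i =>
      change t + (i : ℝ≥0) / h ≤ t + ((i + 1 : ℕ) : ℝ≥0) / h
      gcongr
      simp
  have hind := hS.indep_increments.nat hτ
  set X : ℕ → Ω → ℝ := fun i ω => (S (τ (i + 1)) ω : ℝ) - S (τ i) ω with hX
  have hXm : ∀ i, Measurable (X i) := fun i => (hS.measurable_cast _).sub (hS.measurable_cast _)
  have hX0 : X 0 = fun ω => (S t ω : ℝ) := by
    funext ω
    simp [hX, τ, hS.zero ω]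
  have hgoal : IndepFun (X 0) (fun ω (i : ℕ) => X (i + 1) ω) P := by
    refine IndepFun.indepFun_process (hXm 0) (fun i => hXm (i + 1)) fun I => ?_
    have hd : Disjoint ({0} : Finset ℕ) (I.map ⟨Nat.succ, Nat.succ_injective⟩) := by
      simp
    have h1 := hind.indepFun_finset _ _ hd hXm
    exact h1.comp (measurable_pi_apply (⟨0, by simp⟩ : ({0} : Finset ℕ)))
      (measurable_pi_lambda (fun y (i : I) => y ⟨i + 1, by simp⟩) fun i => measurable_pi_apply _)
  rwa [hX0] at hgoal

/-- Both sequences are independent with every term distributed as `S (1 / h)`, so their joint laws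
agree. -/
theorem identDistrib_increments (hS : IsRegularSubordinator S P) (s t h : ℝ≥0) :
    IdentDistrib
      (fun ω (i : ℕ) => (S (s + ((i + 1 : ℕ) : ℝ≥0) / h) ω : ℝ) - S (s + (i : ℝ≥0) / h) ω)
      (fun ω (i : ℕ) => (S (t + ((i + 1 : ℕ) : ℝ≥0) / h) ω : ℝ) - S (t + (i : ℝ≥0) / h) ω) P P := by
  have hind : ∀ t : ℝ≥0, iIndepFun
      (fun (i : ℕ) ω => (S (t + ((i + 1 : ℕ) : ℝ≥0) / h) ω : ℝ) - S (t + (i : ℝ≥0) / h) ω) P :=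
    fun t => hS.indep_increments.nat (t := fun i : ℕ => t + (i : ℝ≥0) / h)
      fun i j hij => by dsimp only; gcongr
  have hstat : ∀ (t : ℝ≥0) (i : ℕ), IdentDistrib
      (fun ω => (S (t + ((i + 1 : ℕ) : ℝ≥0) / h) ω : ℝ) - S (t + (i : ℝ≥0) / h) ω)
      (fun ω => (S (1 / h) ω : ℝ)) P P := fun t i => by
    have e : t + ((i + 1 : ℕ) : ℝ≥0) / h = t + (i : ℝ≥0) / h + 1 / h := by
      push_cast
      ring
    rw [e]
    exact hS.stationary_increments _ _
  exact IdentDistrib.pi (fun i => (hstat s i).trans (hstat t i).symm) (hind s) (hind t)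

/-- The Markov property, for moments of the exponential functional after time `t`. -/
theorem lintegral_pow_mul_shift (hS : IsRegularSubordinator S P) [IsProbabilityMeasure P]
    (hQ : Q ≤ 1) (t : ℝ≥0) (m n : ℕ) :
    ∫⁻ ω, (Q ^ m) ^ S t ω * (∫⁻ u in Ioi (0 : ℝ), Q ^ (S (t + u.toNNReal) ω - S t ω)) ^ n ∂P =
      (∫⁻ ω, (Q ^ m) ^ S t ω ∂P) * ∫⁻ ω, (∫⁻ u in Ioi (0 : ℝ), Q ^ S u.toNNReal ω) ^ n ∂P := by
  set Y : ℝ≥0 → ℕ → Ω → ℕ → ℝ := fun t k ω i =>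
    (S (t + ((i + 1 : ℕ) : ℝ≥0) / 2 ^ k) ω : ℝ) - S (t + (i : ℝ≥0) / 2 ^ k) ω with hY
  have hYm : ∀ t k, Measurable (Y t k) := fun t k => measurable_pi_lambda _ fun i =>
    (hS.measurable_cast _).sub (hS.measurable_cast _)
  have hg : ∀ k, Measurable fun y => gridFunctional Q k y ^ n := fun k =>
    (measurable_gridFunctional Q k).pow_const n
  have hlim := fun t ω => gridFunctional_monotone_tendsto hQ (hS.mono ω) (hS.eventually_eq ω) t
  have hpow : Measurable fun k : ℕ => (Q ^ m) ^ k := measurable_of_countable _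
  -- On a fixed grid the factorization is plain independence of increments, and stationarity moves
  -- the starting time to `0`. Monotone convergence then passes to the limit on both sides.
  have hgrid : ∀ k, ∫⁻ ω, (Q ^ m) ^ S t ω * gridFunctional Q k (Y t k ω) ^ n ∂P =
      (∫⁻ ω, (Q ^ m) ^ S t ω ∂P) * ∫⁻ ω, gridFunctional Q k (Y 0 k ω) ^ n ∂P := by
    intro k
    have hind := (hS.indepFun_increments t (2 ^ k)).comp
      (φ := fun x => (Q ^ m) ^ ⌊x⌋₊) (ψ := fun y => gridFunctional Q k y ^ n)
      (hpow.comp Nat.measurable_floor) (hg k)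
    have h1 := lintegral_mul_eq_lintegral_mul_lintegral_of_indepFun
      ((hpow.comp Nat.measurable_floor).comp (hS.measurable_cast t)) ((hg k).comp (hYm t k)) hind
    simp only [Pi.mul_apply, Function.comp_apply, Nat.floor_natCast] at h1
    rw [h1]
    congr 1
    exact ((hS.identDistrib_increments t 0 (2 ^ k)).comp (hg k)).lintegral_eq
  have hp0 : ∀ ω, ∫⁻ u in Ioi (0 : ℝ), Q ^ S u.toNNReal ω =
      ∫⁻ u in Ioi (0 : ℝ), Q ^ (S (0 + u.toNNReal) ω - S 0 ω) := fun ω => by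
    simp [hS.zero ω]
  simp_rw [hp0]
  have l1 : Tendsto (fun k => ∫⁻ ω, (Q ^ m) ^ S t ω * gridFunctional Q k (Y t k ω) ^ n ∂P) atTop
      (𝓝 (∫⁻ ω, (Q ^ m) ^ S t ω *
        (∫⁻ u in Ioi (0 : ℝ), Q ^ (S (t + u.toNNReal) ω - S t ω)) ^ n ∂P)) := by
    refine lintegral_tendsto_of_tendsto_of_monotone (fun k => ?_) (Eventually.of_forall fun ω => ?_)
      (Eventually.of_forall fun ω => ?_)
    · exact ((hpow.comp (hS.measurable t)).mul ((hg k).comp (hYm t k))).aemeasurable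
    · exact fun k l hkl => by
        have := (hlim t ω).1 hkl
        dsimp only at this ⊢
        gcongr
    · refine ENNReal.Tendsto.const_mul ((ENNReal.continuous_pow n).continuousAt.tendsto.comp
        (hlim t ω).2) (Or.inr ?_)
      exact ENNReal.pow_ne_top (ENNReal.pow_ne_top (ne_top_of_le_ne_top ENNReal.one_ne_top hQ))
  have l2 : Tendsto (fun k => ∫⁻ ω, gridFunctional Q k (Y 0 k ω) ^ n ∂P) atTop
      (𝓝 (∫⁻ ω, (∫⁻ u in Ioi (0 : ℝ), Q ^ (S (0 + u.toNNReal) ω - S 0 ω)) ^ n ∂P)) := by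
    refine lintegral_tendsto_of_tendsto_of_monotone (fun k => ((hg k).comp (hYm 0 k)).aemeasurable)
      (Eventually.of_forall fun ω => ?_) (Eventually.of_forall fun ω => ?_)
    · exact fun k l hkl => by
        have := (hlim 0 ω).1 hkl
        dsimp only at this ⊢
        gcongr
    · exact (ENNReal.continuous_pow n).continuousAt.tendsto.comp (hlim 0 ω).2
  have hfin : ∫⁻ ω, (Q ^ m) ^ S t ω ∂P ≠ ∞ := by
    refine ne_top_of_le_ne_top ENNReal.one_ne_top ?_
    calc ∫⁻ ω, (Q ^ m) ^ S t ω ∂P ≤ ∫⁻ _, 1 ∂P :=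
          lintegral_mono fun ω => pow_le_one' (pow_le_one' hQ m) _
      _ = 1 := by simp
  simp_rw [hgrid] at l1
  exact tendsto_nhds_unique l1 (ENNReal.Tendsto.const_mul l2 (Or.inr hfin))

/-- Joint measurability comes from approximating the time from the right by grid points, of which
each grid has countably many. -/
theorem measurable_uncurry (hS : IsRegularSubordinator S P) :
    Measurable fun x : Ω × ℝ => S x.2.toNNReal x.1 := by
  refine measurable_of_tendsto_metrizable (f := fun (k : ℕ) (x : Ω × ℝ) =>
    S ((dyadicIndex k x.2 : ℝ≥0) / 2 ^ k) x.1) (fun k => ?_) (tendsto_pi_nhds.2 fun x => ?_)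
  · have h1 : Measurable fun x : Ω × ℕ => S ((x.2 : ℝ≥0) / 2 ^ k) x.1 :=
      measurable_from_prod_countable_left fun n => hS.measurable ((n : ℝ≥0) / 2 ^ k)
    exact h1.comp (measurable_fst.prodMk ((measurable_dyadicIndex k).comp measurable_snd))
  · have h : Tendsto (fun k : ℕ => (dyadicIndex k x.2 : ℝ≥0) / 2 ^ k) atTop
        (𝓝[≥] x.2.toNNReal) :=
      tendsto_nhdsWithin_iff.2 ⟨tendsto_dyadicIndex_div x.2,
        Eventually.of_forall fun k => le_dyadicIndex_div k x.2⟩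
    refine tendsto_const_nhds.congr' ?_
    filter_upwards [h.eventually (hS.eventually_eq x.1 _)] with k hk
    rw [hk]

theorem measurable_pow_uncurry (hS : IsRegularSubordinator S P) (Q : ℝ≥0∞) :
    Measurable fun x : Ω × ℝ => Q ^ S x.2.toNNReal x.1 :=
  (measurable_of_countable fun k : ℕ => Q ^ k).comp hS.measurable_uncurry

theorem measurable_lintegral_pow (hS : IsRegularSubordinator S P) (Q : ℝ≥0∞) :
    Measurable fun ω => ∫⁻ u in Ioi (0 : ℝ), Q ^ S u.toNNReal ω :=
  (hS.measurable_pow_uncurry Q).lintegral_prod_right'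

theorem lintegral_lintegral_pow (hS : IsRegularSubordinator S P) [IsProbabilityMeasure P]
    (Q : ℝ≥0∞) :
    ∫⁻ ω, (∫⁻ u in Ioi (0 : ℝ), Q ^ S u.toNNReal ω) ∂P = ∫⁻ u in Ioi (0 : ℝ), ∫⁻ ω, Q ^ S u.toNNReal ω ∂P :=
  lintegral_lintegral_swap (hS.measurable_pow_uncurry Q).aemeasurable

/-- The recursion for the moments of the exponential functional. -/
theorem lintegral_pow_succ (hS : IsRegularSubordinator S P) [IsProbabilityMeasure P]
    (hQ : Q ≤ 1) (hfin : ∀ᵐ ω ∂P, ∫⁻ u in Ioi (0 : ℝ), Q ^ S u.toNNReal ω ≠ ∞) (n : ℕ) :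
    ∫⁻ ω, (∫⁻ u in Ioi (0 : ℝ), Q ^ S u.toNNReal ω) ^ (n + 1) ∂P =
      (n + 1) * (∫⁻ t in Ioi (0 : ℝ), ∫⁻ ω, (Q ^ (n + 1)) ^ S t.toNNReal ω ∂P) *
        ∫⁻ ω, (∫⁻ u in Ioi (0 : ℝ), Q ^ S u.toNNReal ω) ^ n ∂P := by
  have hQt : Q ≠ ∞ := ne_top_of_le_ne_top ENNReal.one_ne_top hQ
  have hmQ := hS.measurable_pow_uncurry Q
  have hpath : ∀ᵐ ω ∂P, (∫⁻ u in Ioi (0 : ℝ), Q ^ S u.toNNReal ω) ^ (n + 1) =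
      (n + 1) * ∫⁻ t in Ioi (0 : ℝ), Q ^ S t.toNNReal ω *
        (∫⁻ u in Ioi t, Q ^ S u.toNNReal ω) ^ n := by
    filter_upwards [hfin] with ω hω
    refine pow_lintegral_Ioi_eq (hmQ.comp measurable_prodMk_left) hω
      (fun t => ENNReal.pow_ne_top hQt) (fun t ht => ?_) n
    refine (continuousWithinAt_const (b := Q ^ S t.toNNReal ω)).congr_of_eventuallyEq ?_ rfl
    have h : Tendsto Real.toNNReal (𝓝[>] t) (𝓝[≥] t.toNNReal) :=
      tendsto_nhdsWithin_iff.2 ⟨continuous_real_toNNReal.continuousAt.tendsto.mono_left inf_le_left,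
        by filter_upwards [self_mem_nhdsWithin] with s hs using Real.toNNReal_le_toNNReal (le_of_lt hs)⟩
    filter_upwards [h.eventually (hS.eventually_eq ω t.toNNReal)] with s hs
    simp only [Function.comp_apply, hs]
  -- The tail contributes `n` factors `Q^{S_t}` and the integrand one more, whence the power `n +
  -- 1`.
  have htail : ∀ t : ℝ, 0 < t → ∀ ω, Q ^ S t.toNNReal ω *
        (∫⁻ u in Ioi t, Q ^ S u.toNNReal ω) ^ n =
      (Q ^ (n + 1)) ^ S t.toNNReal ω *
        (∫⁻ u in Ioi (0 : ℝ), Q ^ (S (t.toNNReal + u.toNNReal) ω - S t.toNNReal ω)) ^ n := by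
    intro t ht ω
    have e : ∫⁻ u in Ioi t, Q ^ S u.toNNReal ω = Q ^ S t.toNNReal ω *
        ∫⁻ u in Ioi (0 : ℝ), Q ^ (S (t.toNNReal + u.toNNReal) ω - S t.toNNReal ω) := by
      have h := setLIntegral_Ioi_comp_toNNReal (fun s => Q ^ S s ω) t.toNNReal
      rw [Real.coe_toNNReal _ ht.le] at h
      rw [h, ← lintegral_const_mul' _ _ (ENNReal.pow_ne_top hQt)]
      refine lintegral_congr fun u => ?_
      rw [← pow_add, Nat.add_sub_cancel' (hS.mono ω le_self_add)]
    rw [e, mul_pow, ← mul_assoc, ← pow_succ', ← pow_mul, ← pow_mul, mul_comm (n + 1)]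
  have hmeas : Measurable fun x : Ω × ℝ => Q ^ S x.2.toNNReal x.1 *
      (∫⁻ u in Ioi x.2, Q ^ S u.toNNReal x.1) ^ n := by
    refine hmQ.mul (Measurable.pow_const ?_ n)
    -- The variable lower limit is moved into an indicator, so that measurability of parametric
    -- integrals applies.
    have h1 : ∀ x : Ω × ℝ, ∫⁻ u in Ioi x.2, Q ^ S u.toNNReal x.1 =
        ∫⁻ u, {y : (Ω × ℝ) × ℝ | y.1.2 < y.2}.indicator
          (fun y => Q ^ S y.2.toNNReal y.1.1) (x, u) := fun x => by
      rw [← lintegral_indicator measurableSet_Ioi]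
      rfl
    simp_rw [h1]
    refine Measurable.lintegral_prod_right' (Measurable.indicator ?_ ?_)
    · exact hmQ.comp ((measurable_fst.comp measurable_fst).prodMk measurable_snd)
    · exact measurableSet_lt (measurable_snd.comp measurable_fst) measurable_snd
  rw [lintegral_congr_ae hpath, lintegral_const_mul _ hmeas.lintegral_prod_right',
    lintegral_lintegral_swap hmeas.aemeasurable, mul_assoc]
  congr 1
  rw [← lintegral_mul_const _ ((hS.measurable_pow_uncurry (Q ^ (n + 1))).lintegral_prod_left')]
  refine setLIntegral_congr_fun measurableSet_Ioi fun t ht => ?_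
  exact (lintegral_congr fun ω => htail t ht ω).trans
    (hS.lintegral_pow_mul_shift hQ t.toNNReal (n + 1) n)

end IsRegularSubordinator

/-! ### Identification of a density from moments -/

/-- A continuous function on `(0, ∞)` whose moments are those of a measure on `[0, ∞)` is a
density of that measure, if both have exponential moments. In particular it is nonnegative. -/
theorem eq_withDensity_of_forall_integral_pow_eq {μ : Measure ℝ} [IsFiniteMeasure μ] {φ : ℝ → ℝ}
    {u : ℝ} (hu : 0 < u) (hφ : ContinuousOn φ (Ioi 0))
    (hφi : IntegrableOn (fun x => Real.exp (u * x) * φ x) (Ioi 0)) (hμ : ∀ᵐ x ∂μ, 0 ≤ x)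
    (hμi : Integrable (fun x => Real.exp (u * x)) μ)
    (hmom : ∀ n : ℕ, ∫ x, x ^ n ∂μ = ∫ x in Ioi 0, x ^ n * φ x) :
    (∀ x, 0 < x → 0 ≤ φ x) ∧
      μ = (volume.restrict (Ioi 0)).withDensity fun x => ENNReal.ofReal (φ x) := by
  set ν : Measure ℝ := volume.restrict (Ioi 0) with hν
  have hφm : AEStronglyMeasurable φ ν := hφ.aestronglyMeasurable measurableSet_Ioi
  have hφint : Integrable φ ν := by
    refine Integrable.mono hφi hφm ?_
    filter_upwards [ae_restrict_mem measurableSet_Ioi] with x hx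
    rw [norm_mul]
    refine le_mul_of_one_le_left (norm_nonneg _) ?_
    rw [Real.norm_eq_abs, Real.abs_exp]
    exact Real.one_le_exp (mul_nonneg hu.le (le_of_lt hx))
  -- Applied to `φ` and `-φ`: `ENNReal.ofReal` truncates at `0`, so these are the positive and
  -- negative parts.
  have part : ∀ ψ : ℝ → ℝ, Integrable ψ ν → Integrable (fun x => Real.exp (u * x) * ψ x) ν →
      IsFiniteMeasure (ν.withDensity fun x => ENNReal.ofReal (ψ x)) ∧
      0 ∈ interior (integrableExpSet id (ν.withDensity fun x => ENNReal.ofReal (ψ x))) ∧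
      ∀ n : ℕ, Integrable (fun x => x ^ n * max (ψ x) 0) ν ∧
        ∫ x, x ^ n ∂(ν.withDensity fun x => ENNReal.ofReal (ψ x)) = ∫ x, x ^ n * max (ψ x) 0 ∂ν := by
    intro ψ hψ hψe
    have hm : AEMeasurable (fun x => ENNReal.ofReal (ψ x)) ν := hψ.1.aemeasurable.ennreal_ofReal
    have hlt : ∀ᵐ x ∂ν, ENNReal.ofReal (ψ x) < ∞ := Eventually.of_forall fun x => by simp
    have hfin : IsFiniteMeasure (ν.withDensity fun x => ENNReal.ofReal (ψ x)) :=
      isFiniteMeasure_withDensity_ofReal hψ.2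
    have hiff : ∀ g : ℝ → ℝ, Integrable g (ν.withDensity fun x => ENNReal.ofReal (ψ x)) ↔
        Integrable (fun x => g x * max (ψ x) 0) ν := fun g => by
      rw [integrable_withDensity_iff_integrable_smul₀' hm hlt]
      simp_rw [ENNReal.toReal_ofReal', smul_eq_mul, mul_comm]
    have hpos : ∀ᵐ x ∂(ν.withDensity fun x => ENNReal.ofReal (ψ x)), 0 ≤ x :=
      (withDensity_absolutelyContinuous _ _).ae_le (by
        filter_upwards [ae_restrict_mem measurableSet_Ioi] with x hx using le_of_lt hx)
    have hexp : Integrable (fun x => Real.exp (u * x))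
        (ν.withDensity fun x => ENNReal.ofReal (ψ x)) := by
      rw [hiff]
      refine hψe.pos_part.congr (Eventually.of_forall fun x => ?_)
      simp only
      rw [mul_max_of_nonneg _ _ (Real.exp_nonneg _), mul_zero]
    have h0 := zero_mem_interior_integrableExpSet hpos hu hexp
    refine ⟨hfin, h0, fun n => ⟨?_, ?_⟩⟩
    · exact (hiff _).1 (integrable_pow_of_mem_interior_integrableExpSet h0 n)
    · rw [integral_withDensity_eq_integral_toReal_smul₀ hm hlt]
      simp_rw [ENNReal.toReal_ofReal', smul_eq_mul, mul_comm]
  obtain ⟨fp, ip, mp⟩ := part φ hφint hφi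
  obtain ⟨fn, iN, mn⟩ := part (fun x => -φ x) hφint.neg
    ((Integrable.neg hφi).congr (Eventually.of_forall fun x => (mul_neg _ _).symm))
  have hμ0 := zero_mem_interior_integrableExpSet hμ hu hμi
  have hsum : 0 ∈ interior (integrableExpSet id
      (μ + ν.withDensity fun x => ENNReal.ofReal (-φ x))) := by
    have h : interior (integrableExpSet id μ) ∩ interior (integrableExpSet id
        (ν.withDensity fun x => ENNReal.ofReal (-φ x))) ⊆ interior (integrableExpSet id
        (μ + ν.withDensity fun x => ENNReal.ofReal (-φ x))) := by
      rw [← interior_inter]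
      exact interior_mono fun t ht => Integrable.add_measure ht.1 ht.2
    exact h ⟨hμ0, iN⟩
  -- Moving the negative part to the left avoids signed measures: both sides are finite positive
  -- measures with the same moments.
  have heq : μ + ν.withDensity (fun x => ENNReal.ofReal (-φ x)) =
      ν.withDensity fun x => ENNReal.ofReal (φ x) := by
    refine Measure.ext_of_forall_integral_pow_eq hsum ip fun n => ?_
    have e : ∫ x, x ^ n * φ x ∂ν =
        ∫ x, x ^ n * max (φ x) 0 ∂ν - ∫ x, x ^ n * max (-φ x) 0 ∂ν := by
      rw [← integral_sub (mp n).1 (mn n).1]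
      refine integral_congr_ae (Eventually.of_forall fun x => ?_)
      rcases le_total 0 (φ x) with h | h
      · simp [max_eq_left h, max_eq_right (neg_nonpos.2 h)]
      · simp [max_eq_right h, max_eq_left (neg_nonneg.2 h)]
    rw [integral_add_measure (f := fun x => x ^ n)
      (integrable_pow_of_mem_interior_integrableExpSet hμ0 n)
      (integrable_pow_of_mem_interior_integrableExpSet iN n), hmom, (mn n).2, (mp n).2, e,
      sub_add_cancel]
  -- The positive part has no mass on `A`, hence by `heq` neither has the negative part. So `A` is
  -- Lebesgue-null, and being open it is empty.
  set A : Set ℝ := Ioi 0 ∩ φ ⁻¹' Iio 0 with hA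
  have hAo : IsOpen A := hφ.isOpen_inter_preimage isOpen_Ioi isOpen_Iio
  have hAν : ν.restrict A = volume.restrict A := by
    rw [hν, Measure.restrict_restrict hAo.measurableSet, inter_eq_left.2 inter_subset_left]
  have hplus : ν.withDensity (fun x => ENNReal.ofReal (φ x)) A = 0 := by
    rw [withDensity_apply _ hAo.measurableSet]
    refine (setLIntegral_congr_fun hAo.measurableSet fun x hx => ?_).trans lintegral_zero
    exact ENNReal.ofReal_of_nonpos (le_of_lt hx.2)
  have hminus : ν.withDensity (fun x => ENNReal.ofReal (-φ x)) A = 0 := by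
    rw [← heq, Measure.add_apply] at hplus
    exact (add_eq_zero.1 hplus).2
  have hA0 : A = ∅ := by
    have hm : AEMeasurable (fun x => ENNReal.ofReal (-φ x)) (ν.restrict A) :=
      hφm.aemeasurable.neg.ennreal_ofReal.mono_measure Measure.restrict_le_self
    rw [withDensity_apply _ hAo.measurableSet, lintegral_eq_zero_iff' hm, hAν] at hminus
    have h : ∀ᵐ x ∂(volume.restrict A), False := by
      filter_upwards [hminus, ae_restrict_mem hAo.measurableSet] with x hx hxA
      have h1 : -φ x ≤ 0 := ENNReal.ofReal_eq_zero.1 hx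
      exact absurd hxA.2 (not_lt.2 (neg_nonpos.1 h1))
    rw [← hAo.measure_eq_zero_iff volume, ← Measure.restrict_eq_zero, ← ae_eq_bot]
    exact eventually_false_iff_eq_bot.1 h
  have hnonneg : ∀ x, 0 < x → 0 ≤ φ x := fun x hx => by
    by_contra h
    have : x ∈ A := ⟨hx, not_le.1 h⟩
    rw [hA0] at this
    exact this
  refine ⟨hnonneg, ?_⟩
  rw [← heq]
  have h0 : ν.withDensity (fun x => ENNReal.ofReal (-φ x)) = 0 := by
    refine (withDensity_congr_ae ?_).trans withDensity_zero
    filter_upwards [ae_restrict_mem measurableSet_Ioi] with x hx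
    simpa using hnonneg x hx
  rw [h0, add_zero]

/-! ### The moments of the exponential functional -/

theorem lintegral_Ioi_exp_neg_mul {b : ℝ} (hb : 0 < b) :
    ∫⁻ t in Ioi (0 : ℝ), ENNReal.ofReal (Real.exp (-(b * t))) = ENNReal.ofReal (1 / b) := by
  obtain ⟨h1, h2⟩ := integrableOn_pow_mul_exp_neg_mul 0 hb
  simp only [pow_zero, one_mul, Nat.factorial_zero, Nat.cast_one, zero_add, pow_one] at h1 h2
  rw [← h2, ofReal_integral_eq_lintegral_ofReal h1 (Eventually.of_forall fun _ => Real.exp_nonneg _)]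

namespace IsRegularSubordinator

variable {Ω : Type*} [MeasurableSpace Ω] {P : Measure Ω} {S : ℝ≥0 → Ω → ℕ} {q m r : ℝ}
  {p : ℕ → ℝ}

/-- From here on the compound Poisson form enters only through `hlap`, the generating function of
each `S_t`. -/
theorem lintegral_Ioi_pow (hr : 0 < r) (hm : 0 < m) (hp : ∀ k, 0 ≤ p k)
    (hpm : HasSum (fun k => p (k + 1)) m)
    (hlap : ∀ z, 0 ≤ z → z < 1 → ∀ t : ℝ≥0, ∫⁻ ω, ENNReal.ofReal z ^ S t ω ∂P =
      ENNReal.ofReal (Real.exp (-(r * t * (m - ∑' k, p (k + 1) * z ^ (k + 1))))))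
    {z : ℝ} (hz0 : 0 ≤ z) (hz1 : z < 1) :
    ∫⁻ t in Ioi (0 : ℝ), ∫⁻ ω, ENNReal.ofReal z ^ S t.toNNReal ω ∂P =
      ENNReal.ofReal (1 / (r * (m - ∑' k, p (k + 1) * z ^ (k + 1)))) := by
  rw [← lintegral_Ioi_exp_neg_mul (mul_pos hr (sub_pos.2 (tsum_mul_pow_lt hp hm hpm hz0 hz1)))]
  refine setLIntegral_congr_fun measurableSet_Ioi fun t ht => ?_
  rw [hlap z hz0 hz1, Real.coe_toNNReal t (le_of_lt ht), mul_right_comm]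

theorem ae_lintegral_ne_top (hS : IsRegularSubordinator S P) [IsProbabilityMeasure P]
    (hq0 : 0 < q) (hq1 : q < 1) (hr : 0 < r) (hm : 0 < m)
    (hp : ∀ k, 0 ≤ p k) (hpm : HasSum (fun k => p (k + 1)) m)
    (hlap : ∀ z, 0 ≤ z → z < 1 → ∀ t : ℝ≥0, ∫⁻ ω, ENNReal.ofReal z ^ S t ω ∂P =
      ENNReal.ofReal (Real.exp (-(r * t * (m - ∑' k, p (k + 1) * z ^ (k + 1)))))) :
    ∀ᵐ ω ∂P, ∫⁻ u in Ioi (0 : ℝ), ENNReal.ofReal q ^ S u.toNNReal ω ≠ ∞ := by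
  have h1 := (hS.lintegral_lintegral_pow (ENNReal.ofReal q)).trans
    (lintegral_Ioi_pow hr hm hp hpm hlap hq0.le hq1)
  filter_upwards [ae_lt_top (hS.measurable_lintegral_pow _) (h1 ▸ ENNReal.ofReal_ne_top)]
    with ω hω using hω.ne

/-- The moments of the exponential functional. -/
theorem lintegral_pow_eq (hS : IsRegularSubordinator S P) [IsProbabilityMeasure P]
    (hq0 : 0 < q) (hq1 : q < 1) (hr : 0 < r) (hm : 0 < m)
    (hp : ∀ k, 0 ≤ p k) (hpm : HasSum (fun k => p (k + 1)) m)
    (hlap : ∀ z, 0 ≤ z → z < 1 → ∀ t : ℝ≥0, ∫⁻ ω, ENNReal.ofReal z ^ S t ω ∂P =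
      ENNReal.ofReal (Real.exp (-(r * t * (m - ∑' k, p (k + 1) * z ^ (k + 1)))))) (n : ℕ) :
    ∫⁻ ω, (∫⁻ u in Ioi (0 : ℝ), ENNReal.ofReal q ^ S u.toNNReal ω) ^ n ∂P =
      ENNReal.ofReal (n.factorial / (r * m) ^ n *
        ((∑' j, densityCoeff q m p j * (q ^ (n + 1)) ^ j) /
          ∑' j, densityCoeff q m p j * q ^ j)) := by
  have hC := tsum_densityCoeff_mul_pow_pos hq0 hq1 hm hp hpm
  have hC0 := hC 0
  simp only [zero_add, pow_one] at hC0
  induction n with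
  | zero => simp [div_self hC0.ne']
  | succ n ih =>
    have hz1 : q ^ (n + 1) < 1 := pow_lt_one₀ hq0.le hq1 (by omega)
    have hz0 : 0 ≤ q ^ (n + 1) := pow_nonneg hq0.le _
    have hΦ := sub_pos.2 (tsum_mul_pow_lt hp hm hpm hz0 hz1)
    have hfe := tsum_densityCoeff_mul_pow_eq hq0 hq1 hm hp hpm hz0 hz1
    rw [← pow_succ'] at hfe
    have hcast : ((n : ℝ≥0∞) + 1) = ENNReal.ofReal (n + 1) := by
      rw [ENNReal.ofReal_add (by positivity) zero_le_one]
      simp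
    rw [hS.lintegral_pow_succ (ENNReal.ofReal_le_one.2 hq1.le)
      (hS.ae_lintegral_ne_top hq0 hq1 hr hm hp hpm hlap), ih, ← ENNReal.ofReal_pow hq0.le,
      lintegral_Ioi_pow hr hm hp hpm hlap hz0 hz1, hcast, ← ENNReal.ofReal_mul (by positivity),
      ← ENNReal.ofReal_mul (by positivity)]
    congr 1
    set g := m - ∑' k, p (k + 1) * (q ^ (n + 1)) ^ (k + 1)
    set C1 := ∑' j, densityCoeff q m p j * (q ^ (n + 1)) ^ j
    set C2 := ∑' j, densityCoeff q m p j * (q ^ (n + 1 + 1)) ^ j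
    -- The functional equation at `z = q^{n+1}` replaces `1 / Φ(z)` by a quotient of consecutive
    -- values of `C`.
    have hC1 : C1 = g * C2 / m := by
      rw [eq_div_iff hm.ne', mul_comm, hfe]
    rw [hC1, Nat.factorial_succ, pow_succ]
    push_cast
    field_simp

end IsRegularSubordinator

/-! ### The law of the exponential functional -/

namespace IsRegularSubordinator

variable {Ω : Type*} [MeasurableSpace Ω] {P : Measure Ω} {S : ℝ≥0 → Ω → ℕ} {q m r : ℝ}
  {p : ℕ → ℝ}

/-- The `n`-th moment is at most a constant times `n! / a^n`, so at exponent `a/2` the exponential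
series is dominated by `∑ (1/2)^n`. -/
theorem integrable_exp_mul (hS : IsRegularSubordinator S P) [IsProbabilityMeasure P]
    (hq0 : 0 < q) (hq1 : q < 1) (hr : 0 < r) (hm : 0 < m)
    (hp : ∀ k, 0 ≤ p k) (hpm : HasSum (fun k => p (k + 1)) m)
    (hlap : ∀ z, 0 ≤ z → z < 1 → ∀ t : ℝ≥0, ∫⁻ ω, ENNReal.ofReal z ^ S t ω ∂P =
      ENNReal.ofReal (Real.exp (-(r * t * (m - ∑' k, p (k + 1) * z ^ (k + 1)))))) :
    Integrable (fun ω => Real.exp (r * m / 2 *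
      (∫⁻ u in Ioi (0 : ℝ), ENNReal.ofReal q ^ S u.toNNReal ω).toReal)) P := by
  obtain ⟨K, hK0, hK⟩ := exists_abs_densityCoeff_le hq0 hq1 hm hp hpm
  have hC0 := tsum_densityCoeff_mul_pow_pos hq0 hq1 hm hp hpm 0
  simp only [zero_add, pow_one] at hC0
  set I : Ω → ℝ≥0∞ := fun ω => ∫⁻ u in Ioi (0 : ℝ), ENNReal.ofReal q ^ S u.toNNReal ω with hI
  have hIm : Measurable I := hS.measurable_lintegral_pow _
  set C := ∑' j, densityCoeff q m p j * q ^ j with hC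
  have ha : 0 < r * m := mul_pos hr hm
  have hbound : ∀ n : ℕ, ∑' j, densityCoeff q m p j * (q ^ (n + 1)) ^ j ≤ K * (1 - q)⁻¹ := by
    intro n
    rw [← tsum_geometric_of_lt_one hq0.le hq1, ← tsum_mul_left]
    refine (summable_mul_pow_of_abs_le hK (by positivity)
      (pow_lt_one₀ hq0.le hq1 (by omega))).tsum_le_tsum (fun j => ?_)
      ((summable_geometric_of_lt_one hq0.le hq1).mul_left K)
    exact mul_le_mul ((le_abs_self _).trans (hK j))
      (pow_le_pow_left₀ (by positivity) (pow_le_of_le_one hq0.le hq1.le (by omega)) j)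
      (by positivity) hK0
  have hexp : ∀ ω, ENNReal.ofReal (Real.exp (r * m / 2 * (I ω).toReal)) =
      ∑' n : ℕ, ENNReal.ofReal ((r * m / 2 * (I ω).toReal) ^ n / n.factorial) := fun ω => by
    have hs := NormedSpace.expSeries_div_hasSum_exp (r * m / 2 * (I ω).toReal)
    rw [← Real.exp_eq_exp_ℝ] at hs
    rw [← hs.tsum_eq, ENNReal.ofReal_tsum_of_nonneg (fun n => by positivity) hs.summable]
  have hterm : ∀ n : ℕ, ∫⁻ ω, ENNReal.ofReal ((r * m / 2 * (I ω).toReal) ^ n / n.factorial) ∂P ≤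
      ENNReal.ofReal (K * (1 - q)⁻¹ / C * (1 / 2) ^ n) := by
    intro n
    calc ∫⁻ ω, ENNReal.ofReal ((r * m / 2 * (I ω).toReal) ^ n / n.factorial) ∂P
        ≤ ∫⁻ ω, ENNReal.ofReal ((r * m / 2) ^ n / n.factorial) * I ω ^ n ∂P := by
          refine lintegral_mono fun ω => ?_
          rw [mul_pow, mul_div_right_comm, ENNReal.ofReal_mul (by positivity),
            ENNReal.ofReal_pow ENNReal.toReal_nonneg]
          gcongr
          exact ENNReal.ofReal_toReal_le
      _ = ENNReal.ofReal ((r * m / 2) ^ n / n.factorial * (n.factorial / (r * m) ^ n *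
            ((∑' j, densityCoeff q m p j * (q ^ (n + 1)) ^ j) / C))) := by
          rw [lintegral_const_mul _ (hIm.pow_const n),
            hS.lintegral_pow_eq hq0 hq1 hr hm hp hpm hlap, ← ENNReal.ofReal_mul (by positivity)]
      _ ≤ _ := by
          refine ENNReal.ofReal_le_ofReal ?_
          have e : (r * m / 2) ^ n / n.factorial * (n.factorial / (r * m) ^ n *
              ((∑' j, densityCoeff q m p j * (q ^ (n + 1)) ^ j) / C)) =
              (∑' j, densityCoeff q m p j * (q ^ (n + 1)) ^ j) / C * (1 / 2) ^ n := by
            rw [div_pow, one_div, inv_pow]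
            field_simp
          rw [e]
          gcongr
          exact hbound n
  refine ⟨((hIm.ennreal_toReal.const_mul _).exp).aestronglyMeasurable, ?_⟩
  rw [hasFiniteIntegral_iff_ofReal (Eventually.of_forall fun ω => Real.exp_nonneg _)]
  rw [lintegral_congr hexp]
  rw [lintegral_tsum fun n => by fun_prop]
  refine (ENNReal.tsum_le_tsum hterm).trans_lt ?_
  exact ((summable_geometric_of_lt_one (by norm_num) (by norm_num)).mul_left _).tsum_ofReal_lt_top

theorem nonneg_and_hasLaw (hS : IsRegularSubordinator S P) [IsProbabilityMeasure P]
    (hq0 : 0 < q) (hq1 : q < 1) (hr : 0 < r) (hm : 0 < m)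
    (hp : ∀ k, 0 ≤ p k) (hpm : HasSum (fun k => p (k + 1)) m)
    (hlap : ∀ z, 0 ≤ z → z < 1 → ∀ t : ℝ≥0, ∫⁻ ω, ENNReal.ofReal z ^ S t ω ∂P =
      ENNReal.ofReal (Real.exp (-(r * t * (m - ∑' k, p (k + 1) * z ^ (k + 1)))))) :
    (∀ x, 0 < x → 0 ≤ seriesDensity (r * m) q (densityCoeff q m p) x) ∧
    HasLaw (fun ω => (∫⁻ u in Ioi (0 : ℝ), ENNReal.ofReal q ^ S u.toNNReal ω).toReal)
      ((volume.restrict (Ioi 0)).withDensity fun x =>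
        ENNReal.ofReal (seriesDensity (r * m) q (densityCoeff q m p) x)) P := by
  obtain ⟨K, hK0, hK⟩ := exists_abs_densityCoeff_le hq0 hq1 hm hp hpm
  have hC := tsum_densityCoeff_mul_pow_pos hq0 hq1 hm hp hpm
  have ha : 0 < r * m := mul_pos hr hm
  set X : Ω → ℝ := fun ω =>
    (∫⁻ u in Ioi (0 : ℝ), ENNReal.ofReal q ^ S u.toNNReal ω).toReal with hX
  have hXm : Measurable X := (hS.measurable_lintegral_pow _).ennreal_toReal
  have hprob : IsProbabilityMeasure (P.map X) :=
    Measure.isProbabilityMeasure_map hXm.aemeasurable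
  have hmom : ∀ n : ℕ, ∫ x, x ^ n ∂(P.map X) =
      ∫ x in Ioi (0 : ℝ), x ^ n * seriesDensity (r * m) q (densityCoeff q m p) x := by
    intro n
    have h1 : ∫ x, x ^ n ∂(P.map X) = n.factorial / (r * m) ^ n *
        ((∑' j, densityCoeff q m p j * (q ^ (n + 1)) ^ j) /
          ∑' j, densityCoeff q m p j * q ^ j) := by
      have hC0 := hC 0
      simp only [zero_add, pow_one] at hC0
      have hpow : ∀ ω, X ω ^ n =
          ((∫⁻ u in Ioi (0 : ℝ), ENNReal.ofReal q ^ S u.toNNReal ω) ^ n).toReal := fun ω =>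
        (ENNReal.toReal_pow _ _).symm
      rw [integral_map hXm.aemeasurable (by fun_prop)]
      simp_rw [hpow]
      rw [integral_toReal ((hS.measurable_lintegral_pow _).pow_const n).aemeasurable,
        hS.lintegral_pow_eq hq0 hq1 hr hm hp hpm hlap, ENNReal.toReal_ofReal]
      · have := hC n
        positivity
      · filter_upwards [hS.ae_lintegral_ne_top hq0 hq1 hr hm hp hpm hlap] with ω hω
        exact ENNReal.pow_lt_top hω.lt_top
    unfold seriesDensity
    simp_rw [mul_left_comm _ (r * m / _)]
    rw [h1, integral_const_mul, integral_pow_mul_tsum ha hq0 hq1 hK]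
    field_simp
    ring
  have key := eq_withDensity_of_forall_integral_pow_eq (μ := P.map X)
    (φ := seriesDensity (r * m) q (densityCoeff q m p)) (half_pos ha)
    (continuousOn_const.mul (continuousOn_tsum_mul_exp_neg_zpow ha hq0 hq1 hK)) ?_ ?_ ?_ hmom
  · exact ⟨key.1, hXm.aemeasurable, key.2⟩
  · unfold seriesDensity
    simp_rw [mul_left_comm _ (r * m / _)]
    exact (integrableOn_mul_exp_tsum ha hq0 hq1 hK).const_mul _
  · exact (ae_map_iff hXm.aemeasurable measurableSet_Ici).2
      (Eventually.of_forall fun ω => ENNReal.toReal_nonneg)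
  · rw [integrable_map_measure (by fun_prop) hXm.aemeasurable]
    exact hS.integrable_exp_mul hq0 hq1 hr hm hp hpm hlap

end IsRegularSubordinator

/-! ### The theorem for the original process -/

theorem mainTheorem1
    {Ω Ω' : Type*} [MeasurableSpace Ω] [MeasurableSpace Ω']
    (P : Measure Ω) [IsProbabilityMeasure P] (P' : Measure Ω') [IsProbabilityMeasure P']
    (S : ℝ≥0 → Ω → ℕ) (hS : IsIntegerValuedSubordinator S P)
    (N : ℝ≥0 → Ω' → ℕ) (Z : ℕ → Ω' → ℕ) (r : ℝ≥0) (hr : 0 < r)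
    (hNZ : IsCompoundPoissonData N Z r P')
    (hZ : 0 < P'.real {ω | 1 ≤ Z 0 ω})
    (hform : ∀ t, IdentDistrib (S t) (compoundSum N Z t) P P')
    (q : ℝ) (hq : q ∈ Ioo (0 : ℝ) 1)
    (a : ℝ) (ha : a = r * P'.real {ω | 1 ≤ Z 0 ω})
    (c : ℕ → ℝ)
    (hc : c = densityCoeff q (P'.real {ω | 1 ≤ Z 0 ω}) (fun k => P'.real {ω | Z 0 ω = k})) :
    (∀ᵐ ω ∂P, IntegrableOn (fun t : ℝ => q ^ S t.toNNReal ω) (Ioi 0)) ∧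
    Summable (fun j => c j * q ^ j) ∧
    0 < ∑' j, c j * q ^ j ∧
    (∀ x : ℝ, 0 < x → Summable fun j : ℕ => c j * Real.exp (-(a * q ^ (-(j : ℤ)) * x))) ∧
    (∀ x : ℝ, 0 < x → 0 ≤ seriesDensity a q c x) ∧
    HasLaw (expFunctional q S)
      ((volume.restrict (Ioi 0)).withDensity fun x => ENNReal.ofReal (seriesDensity a q c x)) P := by
  obtain ⟨hq0, hq1⟩ := hq
  set m := P'.real {ω | 1 ≤ Z 0 ω} with hm
  set p : ℕ → ℝ := fun k => P'.real {ω | Z 0 ω = k} with hpdef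
  have hr' : (0 : ℝ) < r := hr
  have hp : ∀ k, 0 ≤ p k := fun k => measureReal_nonneg
  have hpm : HasSum (fun k => p (k + 1)) m :=
    hasSum_measureReal_eq_succ (hNZ.measurable_jumps 0)
  obtain ⟨K, hK0, hK⟩ := exists_abs_densityCoeff_le hq0 hq1 hZ hp hpm
  have ha0 : 0 < a := ha ▸ mul_pos hr' hZ
  obtain ⟨S', hS', hSS'⟩ := hS.exists_regular
  have hlap : ∀ z, 0 ≤ z → z < 1 → ∀ t : ℝ≥0, ∫⁻ ω, ENNReal.ofReal z ^ S' t ω ∂P =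
      ENNReal.ofReal (Real.exp (-(r * t * (m - ∑' k, p (k + 1) * z ^ (k + 1))))) := by
    intro z hz0 hz1 t
    have h1 : ∫⁻ ω, ENNReal.ofReal z ^ S' t ω ∂P = ∫⁻ ω, ENNReal.ofReal z ^ S t ω ∂P :=
      lintegral_congr_ae (by filter_upwards [hSS'] with ω hω using by rw [hω])
    have h2 := ((hform t).comp
      (measurable_of_countable fun k : ℕ => ENNReal.ofReal z ^ k)).lintegral_eq
    have h3 := one_sub_integral_pow (P := P') (hNZ.measurable_jumps 0) hz0 hz1.le
    rw [h1]
    refine h2.trans ((lintegral_pow_compoundSum hNZ t hz0 hz1.le).trans ?_)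
    rw [h3]
  have hfin := hS'.ae_lintegral_ne_top hq0 hq1 hr' hZ hp hpm hlap
  have hof : ∀ n : ℕ, ENNReal.ofReal (q ^ n) = ENNReal.ofReal q ^ n := fun n =>
    ENNReal.ofReal_pow hq0.le n
  have hpath : ∀ ω, AEStronglyMeasurable (fun t : ℝ => q ^ S' t.toNNReal ω)
      (volume.restrict (Ioi 0)) := fun ω =>
    ((measurable_of_countable fun k : ℕ => q ^ k).comp
      (hS'.measurable_uncurry.comp measurable_prodMk_left)).aestronglyMeasurable
  -- The Bochner integral of a nonnegative function is the `toReal` of its lower integral even when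
  -- the latter is infinite, both being `0` then.
  have hfun : expFunctional q S =ᵐ[P] fun ω =>
      (∫⁻ u in Ioi (0 : ℝ), ENNReal.ofReal q ^ S' u.toNNReal ω).toReal := by
    filter_upwards [hSS'] with ω hω
    simp_rw [expFunctional, ← hω]
    rw [integral_eq_lintegral_of_nonneg_ae (Eventually.of_forall fun t => by positivity) (hpath ω)]
    simp_rw [hof]
  obtain ⟨hnonneg, hlaw⟩ := hS'.nonneg_and_hasLaw hq0 hq1 hr' hZ hp hpm hlap
  subst hc
  refine ⟨?_, summable_mul_pow_of_abs_le hK hq0.le hq1, ?_,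
    fun x hx => summable_mul_exp_neg_zpow ha0 hq0 hq1 hK hx, ?_, ?_⟩
  · filter_upwards [hSS', hfin] with ω hω hI
    simp_rw [← hω]
    refine ⟨hpath ω, ?_⟩
    rw [hasFiniteIntegral_iff_ofReal (Eventually.of_forall fun t => by positivity)]
    simp_rw [hof]
    exact hI.lt_top
  · simpa using tsum_densityCoeff_mul_pow_pos hq0 hq1 hZ hp hpm 0
  · rw [ha]
    exact hnonneg
  · rw [ha]
    exact hlaw.congr hfun
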